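/- Let $0<q<1$, and let $c_0,d_0$ satisfy $c_0d_0=1$, where either $c_0,d_0\in\mathbb R$ or $d_0=\overline{c_0}$. **Algebras.** $U_q su(1,1)$ is the $*$-algebra generated by $E,F,K^{\pm1}$ with $KE=q^{-2}EK$, $KF=q^2FK$, $[E,F]=\frac{K-K^{-1}}{q^{-1}-q}$ and $E^*=-KF$, $F^*=-EK^{-1}$, $K^*=K$. Its Casimir element is $C_q=\frac12(EF+FE)+\frac{q^{-1}+q}{2(q^{-1}-q)^2}(K-2+K^{-1})$. $Func(X_{c_0,d_0})_q$ is the $*$-algebra generated by the algebra of all functions $f(x)$ of a real variable $x\neq0$ and by $y,\hat y$, with $yf(x)=f(q^2x)y$, $\hat yf(x)=f(q^{-2}x)\hat y$, $\hat yy=-(q^{-1}x-c_0)(q^{-1}x-d_0)$, $y\hat y=-(qx-c_0)(qx-d_0)$, and $f(x)^*=\bar f(x)$, $y^*=-\hat y$. For $s=\pm1$ (a choice of $(c_0d_0)^{1/2}$) the moment map $J_s:U_qsu(1,1)\to Func(X_{c_0,d_0})_q$ is the $*$-homomorphism $$E\mapsto \frac{q^{1/2}}{q^{-1}-q}\,s\,y,\qquad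 F\mapsto\frac{q^{1/2}}{q^{-1}-q}\,x^{-1}\hat y,\qquad K\mapsto s\,x .$$ **Representations.** A $*$-representation of a $*$-algebra $A$ is an $A$-module $V$ with a positive definite scalar product such that $(av,w)=(v,a^*w)$ and each $a\in A$ has a closed extension in the completion of $V$. It is irreducible if $V\ne0$ and every bounded operator $T$ on the completion of $V$ with $(Tav,w)=(Tv,a^*w)$ for all $a\in A$, $v,w\in V$ is a scalar. For $\nu_0\in\mathbb R\setminus\{0\}$, $\Pi_\nu$ is the $Func(X_{c_0,d_0})_q$-module generated by a vector $\mathbf 1_\nu$ with the relations $f(x)\mathbf 1_\nu=f(\nu_0)\mathbf 1_\nu$, and $\mathfrak M_{\nu_0}=\{\nu_0q^{2k}\}_{k\in\mathbb Z}$. **Series.** An irreducible $*$-representation of $U_qsu(1,1)$ has spin $l\in\mathbb C$ and parity $\varepsilon$, $|\varepsilon|\le\frac12$, if $C_q$ acts as $\frac{(q^l-q^{-l})(q^{l+1}-q^{-l-1})}{(q^{-1}-q)^2}$ and $K$ is diagonalizable with all eigenvalues of the form $q^{2(k+\varepsilon)}$, $k\in\mathbb Z$. It belongs to * the principal continuous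 series if $l\in-\frac12+i\mathbb R$, the complementary series if $l\in(-\frac12,0)$ and $|\varepsilon|<|l|$, the strange series if $\mathrm{Im}\,l=\frac{\pi}{2\log q}$ for some such $(l,\varepsilon)$; in these three cases every $q^{2(k+\varepsilon)}$, $k\in\mathbb Z$, is required to be an eigenvalue of $K$; * the holomorphic discrete series if, for some such $(l,\varepsilon)$, $l\in\mathbb R$, $l-\varepsilon\in\mathbb Z$ and the eigenvalues of $K$ are $q^{2(l+1+k)}$, $k=0,1,2,\dots$; * the anti-holomorphic discrete series if, for some such $(l,\varepsilon)$, $l\in\mathbb R$, $l+\varepsilon\in\mathbb Z$ and the eigenvalues of $K$ are $q^{-2(l+1+k)}$, $k=0,1,2,\dots$. **Theorem.** Let $\pi$ be a $*$-representation of $Func(X_{c_0,d_0})_q$ on $V$, and let $s=\pm1$. Then $\pi\circ J_s$ is a $*$-representation of $U_qsu(1,1)$. If $\pi$ is irreducible, then so is $\pi\circ J_s$; if $V$ is simple as a module over $Func(X_{c_0,d_0})_q$, then it is simple as a module over $U_qsu(1,1)$. Suppose further that $V\ne0$ is $\Pi_\nu$, or a quotient module of it, and let $s$ be the sign of $\nu_0$.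 Then: 1. Let $0<c_0\le d_0$, let $qc_0,q^{-1}d_0\notin\mathfrak M_{\nu_0}$, and let no point of $\mathfrak M_{\nu_0}$ lie in $(qc_0,qd_0)$. If $\nu_0>0$, then $\pi\circ J_s$ belongs to the complementary series when $c_0<d_0$, and to the principal continuous series when $c_0=d_0$. If $\nu_0<0$, then $\pi\circ J_s$ belongs to the strange series. 2. If $d_0=\overline{c_0}\notin\mathbb R$, then $\pi\circ J_s$ belongs to the principal continuous series. 3. Let $0<c_0\le d_0$. If $\nu_0\in\{c_0q^{2k+1}\}_{k\ge0}$, then $\pi\circ J_s$ belongs to the holomorphic discrete series. If $\nu_0\in\{d_0q^{-2k-1}\}_{k\ge0}$, then it belongs to the anti-holomorphic discrete series. -/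

import Mathlib

open scoped ComplexConjugate InnerProductSpace

noncomputable section

namespace QuantumOrbit

/-! ### Conjugate-linear anti-automorphisms of complex algebras -/

section StarConstruction

set_option linter.unusedSectionVars false

/-- The opposite algebra, with scalars acting through complex conjugation. A `ℂ`-algebra
homomorphism `A → ConjOp A` is the same as a conjugate-linear anti-endomorphism of `A`. -/
def ConjOp (A : Type*) : Type _ := Aᵐᵒᵖ

instance (A : Type*) [Ring A] : Ring (ConjOp A) := inferInstanceAs (Ring Aᵐᵒᵖ)

instance (A : Type*) [Ring A] [Algebra ℂ A] : Algebra ℂ (ConjOp A) :=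
  Algebra.compHom Aᵐᵒᵖ (starRingEnd ℂ)

variable {A : Type*} [Ring A] [Algebra ℂ A]

/-- View an element of `A` in `ConjOp A`. -/
def toConjOp (a : A) : ConjOp A := MulOpposite.op a

/-- View an element of `ConjOp A` in `A`. -/
def ofConjOp (a : ConjOp A) : A := MulOpposite.unop a

theorem ofConjOp_toConjOp (a : A) : ofConjOp (toConjOp a) = a := rfl

theorem ofConjOp_add (a b : ConjOp A) : ofConjOp (a + b) = ofConjOp a + ofConjOp b := rfl

theorem ofConjOp_mul (a b : ConjOp A) : ofConjOp (a * b) = ofConjOp b * ofConjOp a := rfl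

theorem ofConjOp_one : ofConjOp (1 : ConjOp A) = 1 := rfl

theorem ofConjOp_zero : ofConjOp (0 : ConjOp A) = 0 := rfl

theorem ofConjOp_algebraMap (r : ℂ) :
    ofConjOp (algebraMap ℂ (ConjOp A) r) = algebraMap ℂ A (conj r) := rfl

theorem ofConjOp_neg (a : ConjOp A) : ofConjOp (-a) = -ofConjOp a := rfl

theorem ofConjOp_sub (a b : ConjOp A) : ofConjOp (a - b) = ofConjOp a - ofConjOp b := rfl

theorem ofConjOp_smul (r : ℂ) (a : ConjOp A) : ofConjOp (r • a) = conj r • ofConjOp a := rfl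

theorem ofConjOp_injective : Function.Injective (ofConjOp : ConjOp A → A) := fun _ _ h =>
  MulOpposite.unop_injective h

/-- The homomorphism of opposite algebras induced by an algebra homomorphism. -/
def conjMap {B : Type*} [Ring B] [Algebra ℂ B] (f : A →ₐ[ℂ] B) : ConjOp A →ₐ[ℂ] ConjOp B where
  toFun a := toConjOp (f (ofConjOp a))
  map_one' := ofConjOp_injective (map_one f)
  map_mul' a b := ofConjOp_injective (map_mul f (ofConjOp b) (ofConjOp a))
  map_zero' := ofConjOp_injective (map_zero f)
  map_add' a b := ofConjOp_injective (map_add f (ofConjOp a) (ofConjOp b))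
  commutes' r := ofConjOp_injective (AlgHom.commutes f (conj r))

/-- The square of a conjugate-linear anti-endomorphism. -/
def conjSquare (φ : A →ₐ[ℂ] ConjOp A) : A →ₐ[ℂ] A where
  toFun a := ofConjOp (φ (ofConjOp (φ a)))
  map_one' := by simp [ofConjOp_one]
  map_mul' a b := by simp [ofConjOp_mul]
  map_zero' := by simp [ofConjOp_zero]
  map_add' a b := by simp [ofConjOp_add]
  commutes' r := by
    rw [AlgHom.commutes, ofConjOp_algebraMap, AlgHom.commutes, ofConjOp_algebraMap]
    simp

/-- The `*`-ring structure given by a conjugate-linear anti-endomorphism of square one. -/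
abbrev starRingOf (φ : A →ₐ[ℂ] ConjOp A) (h : conjSquare φ = AlgHom.id ℂ A) : StarRing A where
  star a := ofConjOp (φ a)
  star_involutive a := DFunLike.congr_fun h a
  star_mul a b := by simp [ofConjOp_mul]
  star_add a b := by simp [ofConjOp_add]

theorem starModuleOf (φ : A →ₐ[ℂ] ConjOp A) (h : conjSquare φ = AlgHom.id ℂ A) :
    letI := starRingOf φ h
    StarModule ℂ A :=
  letI := starRingOf φ h
  ⟨fun r a => by
    change ofConjOp (φ (r • a)) = conj r • ofConjOp (φ a)
    rw [map_smul, ofConjOp_smul]⟩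

end StarConstruction

/-! ### The `*`-algebra `U_q su(1,1)` -/

section Uq

/-- Generators of `U_q sl(2)`; `Ki` stands for the inverse of `K`. -/
inductive UqGen
  | E | F | K | Ki

/-- Defining relations of `U_q sl(2)`. -/
inductive UqRel (q : ℝˣ) : FreeAlgebra ℂ UqGen → FreeAlgebra ℂ UqGen → Prop
  | K_Ki : UqRel q (FreeAlgebra.ι ℂ .K * FreeAlgebra.ι ℂ .Ki) 1
  | Ki_K : UqRel q (FreeAlgebra.ι ℂ .Ki * FreeAlgebra.ι ℂ .K) 1
  | K_E : UqRel q (FreeAlgebra.ι ℂ .K * FreeAlgebra.ι ℂ .E)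
      (((q : ℝ) : ℂ)⁻¹ ^ 2 • (FreeAlgebra.ι ℂ .E * FreeAlgebra.ι ℂ .K))
  | K_F : UqRel q (FreeAlgebra.ι ℂ .K * FreeAlgebra.ι ℂ .F)
      (((q : ℝ) : ℂ) ^ 2 • (FreeAlgebra.ι ℂ .F * FreeAlgebra.ι ℂ .K))
  | E_F : UqRel q
      (FreeAlgebra.ι ℂ .E * FreeAlgebra.ι ℂ .F - FreeAlgebra.ι ℂ .F * FreeAlgebra.ι ℂ .E)
      ((((q : ℝ) : ℂ)⁻¹ - ((q : ℝ) : ℂ))⁻¹ • (FreeAlgebra.ι ℂ .K - FreeAlgebra.ι ℂ .Ki))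

/-- The quantized universal enveloping algebra `U_q sl(2)`. -/
def Uq (q : ℝˣ) : Type := RingQuot (UqRel q)

instance (q : ℝˣ) : Ring (Uq q) := inferInstanceAs (Ring (RingQuot (UqRel q)))

instance (q : ℝˣ) : Algebra ℂ (Uq q) := inferInstanceAs (Algebra ℂ (RingQuot (UqRel q)))

namespace Uq

variable (q : ℝˣ)

/-- The class of a word in the generators. -/
def mk : FreeAlgebra ℂ UqGen →ₐ[ℂ] Uq q := RingQuot.mkAlgHom ℂ (UqRel q)

/-- The generator `E`. -/
def E : Uq q := mk q (FreeAlgebra.ι ℂ .E)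

/-- The generator `F`. -/
def F : Uq q := mk q (FreeAlgebra.ι ℂ .F)

/-- The generator `K`. -/
def K : Uq q := mk q (FreeAlgebra.ι ℂ .K)

/-- The inverse of the generator `K`. -/
def Ki : Uq q := mk q (FreeAlgebra.ι ℂ .Ki)

theorem K_mul_Ki : K q * Ki q = 1 := by
  have h := RingQuot.mkAlgHom_rel ℂ (UqRel.K_Ki (q := q))
  rw [map_mul, map_one] at h
  exact h

theorem Ki_mul_K : Ki q * K q = 1 := by
  have h := RingQuot.mkAlgHom_rel ℂ (UqRel.Ki_K (q := q))
  rw [map_mul, map_one] at h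
  exact h

theorem K_mul_E : K q * E q = ((q : ℝ) : ℂ)⁻¹ ^ 2 • (E q * K q) := by
  have h := RingQuot.mkAlgHom_rel ℂ (UqRel.K_E (q := q))
  rw [map_mul, map_smul, map_mul] at h
  exact h

theorem K_mul_F : K q * F q = ((q : ℝ) : ℂ) ^ 2 • (F q * K q) := by
  have h := RingQuot.mkAlgHom_rel ℂ (UqRel.K_F (q := q))
  rw [map_mul, map_smul, map_mul] at h
  exact h

theorem E_mul_F_sub : E q * F q - F q * E q =
    (((q : ℝ) : ℂ)⁻¹ - ((q : ℝ) : ℂ))⁻¹ • (K q - Ki q) := by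
  have h := RingQuot.mkAlgHom_rel ℂ (UqRel.E_F (q := q))
  rw [map_sub, map_mul, map_mul, map_smul, map_sub] at h
  exact h

variable {q} in
theorem algHom_ext {B : Type*} [Ring B] [Algebra ℂ B] {φ ψ : Uq q →ₐ[ℂ] B}
    (hE : φ (E q) = ψ (E q)) (hF : φ (F q) = ψ (F q)) (hK : φ (K q) = ψ (K q))
    (hKi : φ (Ki q) = ψ (Ki q)) : φ = ψ := by
  apply RingQuot.ringQuot_ext'
  apply FreeAlgebra.hom_ext
  funext g
  cases g
  exacts [hE, hF, hK, hKi]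

/-- The universal property of `U_q sl(2)`. -/
def lift {B : Type*} [Ring B] [Algebra ℂ B] (e f k k' : B) (h₁ : k * k' = 1) (h₂ : k' * k = 1)
    (h₃ : k * e = ((q : ℝ) : ℂ)⁻¹ ^ 2 • (e * k)) (h₄ : k * f = ((q : ℝ) : ℂ) ^ 2 • (f * k))
    (h₅ : e * f - f * e = (((q : ℝ) : ℂ)⁻¹ - ((q : ℝ) : ℂ))⁻¹ • (k - k')) : Uq q →ₐ[ℂ] B :=
  RingQuot.liftAlgHom ℂ
    ⟨FreeAlgebra.lift ℂ (fun g => match g with | .E => e | .F => f | .K => k | .Ki => k'), by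
      intro a b hab
      cases hab <;> simp [h₁, h₂, h₃, h₄, h₅]⟩

theorem lift_E {B : Type*} [Ring B] [Algebra ℂ B] {e f k k' : B} (h₁ h₂ h₃ h₄ h₅) :
    lift q e f k k' h₁ h₂ h₃ h₄ h₅ (E q) = e := by
  simp only [lift, E, mk]
  erw [RingQuot.liftAlgHom_mkAlgHom_apply]
  simp

theorem lift_F {B : Type*} [Ring B] [Algebra ℂ B] {e f k k' : B} (h₁ h₂ h₃ h₄ h₅) :
    lift q e f k k' h₁ h₂ h₃ h₄ h₅ (F q) = f := by
  simp only [lift, F, mk]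
  erw [RingQuot.liftAlgHom_mkAlgHom_apply]
  simp

theorem lift_K {B : Type*} [Ring B] [Algebra ℂ B] {e f k k' : B} (h₁ h₂ h₃ h₄ h₅) :
    lift q e f k k' h₁ h₂ h₃ h₄ h₅ (K q) = k := by
  simp only [lift, K, mk]
  erw [RingQuot.liftAlgHom_mkAlgHom_apply]
  simp

theorem lift_Ki {B : Type*} [Ring B] [Algebra ℂ B] {e f k k' : B} (h₁ h₂ h₃ h₄ h₅) :
    lift q e f k k' h₁ h₂ h₃ h₄ h₅ (Ki q) = k' := by
  simp only [lift, Ki, mk]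
  erw [RingQuot.liftAlgHom_mkAlgHom_apply]
  simp

theorem Ki_mul_F : Ki q * F q = ((q : ℝ) : ℂ)⁻¹ ^ 2 • (F q * Ki q) := by
  have hq : ((q : ℝ) : ℂ) ≠ 0 := by simp
  have h : F q * Ki q = ((q : ℝ) : ℂ) ^ 2 • (Ki q * F q) := by
    calc F q * Ki q = Ki q * (K q * F q) * Ki q := by
          rw [← mul_assoc, Ki_mul_K, one_mul]
      _ = _ := by
          rw [K_mul_F, mul_smul_comm, smul_mul_assoc, mul_assoc, mul_assoc, K_mul_Ki, mul_one]
  rw [h, smul_smul, ← mul_pow, inv_mul_cancel₀ hq, one_pow, one_smul]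

theorem Ki_mul_E : Ki q * E q = ((q : ℝ) : ℂ) ^ 2 • (E q * Ki q) := by
  have hq : ((q : ℝ) : ℂ) ≠ 0 := by simp
  have h : E q * Ki q = ((q : ℝ) : ℂ)⁻¹ ^ 2 • (Ki q * E q) := by
    calc E q * Ki q = Ki q * (K q * E q) * Ki q := by
          rw [← mul_assoc, Ki_mul_K, one_mul]
      _ = _ := by
          rw [K_mul_E, mul_smul_comm, smul_mul_assoc, mul_assoc, mul_assoc, K_mul_Ki, mul_one]
  rw [h, smul_smul, ← mul_pow, mul_inv_cancel₀ hq, one_pow, one_smul]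

/-- The conjugate-linear anti-endomorphism with `E ↦ -K F`, `F ↦ -E K⁻¹`, `K ↦ K`. -/
def starHom : Uq q →ₐ[ℂ] ConjOp (Uq q) :=
  lift q (toConjOp (-(K q * F q))) (toConjOp (-(E q * Ki q))) (toConjOp (K q)) (toConjOp (Ki q))
    (ofConjOp_injective (by exact Ki_mul_K q))
    (ofConjOp_injective (by exact K_mul_Ki q))
    (ofConjOp_injective (by
      rw [ofConjOp_smul, ofConjOp_mul, ofConjOp_mul]
      simp only [ofConjOp_toConjOp]
      have h : K q * (K q * F q) = ((q : ℝ) : ℂ) ^ 2 • (K q * F q * K q) := by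
        rw [K_mul_F, mul_smul_comm, smul_mul_assoc, ← mul_assoc, K_mul_F, smul_mul_assoc]
      have hq : ((q : ℝ) : ℂ) ≠ 0 := by simp
      rw [mul_neg, h, neg_mul, smul_neg, smul_smul]
      simp [hq]))
    (ofConjOp_injective (by
      rw [ofConjOp_smul, ofConjOp_mul, ofConjOp_mul]
      simp only [ofConjOp_toConjOp]
      have hq : ((q : ℝ) : ℂ) ≠ 0 := by simp
      rw [mul_neg, neg_mul, ← mul_assoc, K_mul_E, smul_mul_assoc, mul_assoc, mul_assoc, K_mul_Ki,
        Ki_mul_K, smul_neg, smul_smul]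
      simp [hq]))
    (ofConjOp_injective (by
      rw [ofConjOp_smul, ofConjOp_sub, ofConjOp_sub, ofConjOp_mul, ofConjOp_mul]
      simp only [ofConjOp_toConjOp]
      have h₁ : E q * Ki q * (K q * F q) = E q * F q := by
        rw [mul_assoc, ← mul_assoc (Ki q), Ki_mul_K, one_mul]
      have h₂ : K q * F q * (E q * Ki q) = F q * E q := by
        have h : K q * (F q * E q) = F q * E q * K q := by
          rw [← mul_assoc, K_mul_F, smul_mul_assoc, mul_assoc, K_mul_E, mul_smul_comm, smul_smul,
            ← mul_pow]
          simp [mul_assoc]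
        calc K q * F q * (E q * Ki q) = K q * (F q * E q) * Ki q := by simp only [mul_assoc]
          _ = _ := by rw [h, mul_assoc, K_mul_Ki, mul_one]
      rw [neg_mul_neg, neg_mul_neg, h₁, h₂, E_mul_F_sub]
      simp))

theorem starHom_sq : conjSquare (starHom q) = AlgHom.id ℂ (Uq q) := by
  have hE : ofConjOp (starHom q (E q)) = -(K q * F q) := by
    rw [starHom, lift_E, ofConjOp_toConjOp]
  have hF : ofConjOp (starHom q (F q)) = -(E q * Ki q) := by
    rw [starHom, lift_F, ofConjOp_toConjOp]
  have hK : ofConjOp (starHom q (K q)) = K q := by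
    rw [starHom, lift_K, ofConjOp_toConjOp]
  have hKi : ofConjOp (starHom q (Ki q)) = Ki q := by
    rw [starHom, lift_Ki, ofConjOp_toConjOp]
  apply algHom_ext
  · change ofConjOp (starHom q (ofConjOp (starHom q (E q)))) = E q
    rw [hE, map_neg, map_mul, ofConjOp_neg, ofConjOp_mul, hK, hF]
    rw [neg_mul, neg_neg, mul_assoc, Ki_mul_K, mul_one]
  · change ofConjOp (starHom q (ofConjOp (starHom q (F q)))) = F q
    rw [hF, map_neg, map_mul, ofConjOp_neg, ofConjOp_mul, hKi, hE]
    rw [mul_neg, neg_neg, ← mul_assoc, Ki_mul_K, one_mul]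
  · change ofConjOp (starHom q (ofConjOp (starHom q (K q)))) = K q
    rw [hK, hK]
  · change ofConjOp (starHom q (ofConjOp (starHom q (Ki q)))) = Ki q
    rw [hKi, hKi]

/-- The involution of `U_q su(1,1)`: `E* = -K F`, `F* = -E K⁻¹`, `K* = K`. -/
instance : StarRing (Uq q) := starRingOf (starHom q) (starHom_sq q)

theorem star_E : star (E q) = -(K q * F q) := by
  change ofConjOp (starHom q (E q)) = _
  rw [starHom, lift_E, ofConjOp_toConjOp]

theorem star_F : star (F q) = -(E q * Ki q) := by
  change ofConjOp (starHom q (F q)) = _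
  rw [starHom, lift_F, ofConjOp_toConjOp]

theorem star_K : star (K q) = K q := by
  change ofConjOp (starHom q (K q)) = _
  rw [starHom, lift_K, ofConjOp_toConjOp]

theorem star_Ki : star (Ki q) = Ki q := by
  change ofConjOp (starHom q (Ki q)) = _
  rw [starHom, lift_Ki, ofConjOp_toConjOp]

instance : StarModule ℂ (Uq q) := starModuleOf (starHom q) (starHom_sq q)

/-- The quantum quadratic Casimir element
`C_q = (EF + FE) / 2 + (q⁻¹ + q) / (2 (q⁻¹ - q)²) · (K - 2 + K⁻¹)`. -/
def casimir : Uq q :=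
  (1 / 2 : ℂ) • (E q * F q + F q * E q) +
    ((((q : ℝ) : ℂ)⁻¹ + ((q : ℝ) : ℂ)) / (2 * (((q : ℝ) : ℂ)⁻¹ - ((q : ℝ) : ℂ)) ^ 2)) •
      (K q - 2 + Ki q)

end Uq

end Uq

/-! ### The `*`-algebra of functions on a quantum hyperboloid -/

section Func

/-- The parameters `c₀, d₀` of a quantum hyperboloid (or cone), normalized by `c₀ d₀ = 1`:
either both are real, or they are complex conjugate to each other. -/
structure Hyperboloid where
  c : ℂ
  d : ℂ
  mul_eq_one : c * d = 1
  real_or_conj : (conj c = c ∧ conj d = d) ∨ d = conj c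

/-- The value of the polynomial `(t - c₀) (t - d₀)` at a real point. -/
def Hyperboloid.poly (X : Hyperboloid) (t : ℝ) : ℂ := (t - X.c) * (t - X.d)

theorem Hyperboloid.conj_poly (X : Hyperboloid) (t : ℝ) : conj (X.poly t) = X.poly t := by
  rcases X.real_or_conj with ⟨h₁, h₂⟩ | h
  · simp [Hyperboloid.poly, h₁, h₂]
  · simp [Hyperboloid.poly, h, mul_comm]

/-- Generators of the algebra of functions on a quantum hyperboloid: the functions `f(x)` of the
invertible real coordinate `x`, and `y`, `ŷ` (written `yh`). -/
inductive FuncGen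
  | fn (f : ℝˣ → ℂ)
  | y
  | yh

/-- Defining relations of the algebra of functions on a quantum hyperboloid. The first three say
that `f ↦ f(x)` is a homomorphism of `ℂ`-algebras; the remaining ones are
`y f(x) = f(q² x) y`, `ŷ f(x) = f(q⁻² x) ŷ`,
`ŷ y = -(q⁻¹ x - c₀) (q⁻¹ x - d₀)`, `y ŷ = -(q x - c₀) (q x - d₀)`. -/
inductive FuncRel (q : ℝˣ) (X : Hyperboloid) :
    FreeAlgebra ℂ FuncGen → FreeAlgebra ℂ FuncGen → Prop
  | fn_add (f g : ℝˣ → ℂ) : FuncRel q X (FreeAlgebra.ι ℂ (.fn (f + g)))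
      (FreeAlgebra.ι ℂ (.fn f) + FreeAlgebra.ι ℂ (.fn g))
  | fn_mul (f g : ℝˣ → ℂ) : FuncRel q X (FreeAlgebra.ι ℂ (.fn (f * g)))
      (FreeAlgebra.ι ℂ (.fn f) * FreeAlgebra.ι ℂ (.fn g))
  | fn_const (a : ℂ) : FuncRel q X (FreeAlgebra.ι ℂ (.fn (fun _ => a)))
      (algebraMap ℂ (FreeAlgebra ℂ FuncGen) a)
  | y_fn (f : ℝˣ → ℂ) : FuncRel q X (FreeAlgebra.ι ℂ .y * FreeAlgebra.ι ℂ (.fn f))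
      (FreeAlgebra.ι ℂ (.fn (fun x => f (q ^ 2 * x))) * FreeAlgebra.ι ℂ .y)
  | yh_fn (f : ℝˣ → ℂ) : FuncRel q X (FreeAlgebra.ι ℂ .yh * FreeAlgebra.ι ℂ (.fn f))
      (FreeAlgebra.ι ℂ (.fn (fun x => f (q⁻¹ ^ 2 * x))) * FreeAlgebra.ι ℂ .yh)
  | yh_y : FuncRel q X (FreeAlgebra.ι ℂ .yh * FreeAlgebra.ι ℂ .y)
      (FreeAlgebra.ι ℂ (.fn (fun x => -X.poly ((q⁻¹ * x : ℝˣ) : ℝ))))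
  | y_yh : FuncRel q X (FreeAlgebra.ι ℂ .y * FreeAlgebra.ι ℂ .yh)
      (FreeAlgebra.ι ℂ (.fn (fun x => -X.poly ((q * x : ℝˣ) : ℝ))))

/-- The algebra of functions on the quantum hyperboloid `X_{c₀,d₀}`. -/
def Func (q : ℝˣ) (X : Hyperboloid) : Type := RingQuot (FuncRel q X)

instance (q : ℝˣ) (X : Hyperboloid) : Ring (Func q X) :=
  inferInstanceAs (Ring (RingQuot (FuncRel q X)))

instance (q : ℝˣ) (X : Hyperboloid) : Algebra ℂ (Func q X) :=
  inferInstanceAs (Algebra ℂ (RingQuot (FuncRel q X)))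

namespace Func

variable (q : ℝˣ) (X : Hyperboloid)

/-- The class of a word in the generators. -/
def mk : FreeAlgebra ℂ FuncGen →ₐ[ℂ] Func q X := RingQuot.mkAlgHom ℂ (FuncRel q X)

theorem mk_rel {a b : FreeAlgebra ℂ FuncGen} (h : FuncRel q X a b) : mk q X a = mk q X b :=
  RingQuot.mkAlgHom_rel ℂ h

/-- The element `f(x)`, as a homomorphism from the algebra of functions of a nonzero real
variable. -/
def fn : (ℝˣ → ℂ) →ₐ[ℂ] Func q X where
  toFun f := mk q X (FreeAlgebra.ι ℂ (.fn f))
  map_one' := by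
    have h := mk_rel q X (FuncRel.fn_const 1)
    rw [AlgHom.commutes, map_one] at h
    exact h
  map_mul' f g := by
    have h := mk_rel q X (FuncRel.fn_mul f g)
    rw [map_mul] at h
    exact h
  map_zero' := by
    have h := mk_rel q X (FuncRel.fn_const 0)
    rw [AlgHom.commutes, map_zero] at h
    exact h
  map_add' f g := by
    have h := mk_rel q X (FuncRel.fn_add f g)
    rw [map_add] at h
    exact h
  commutes' a := by
    have h := mk_rel q X (FuncRel.fn_const a)
    rw [AlgHom.commutes] at h
    exact h

/-- The generator `y`. -/
def y : Func q X := mk q X (FreeAlgebra.ι ℂ .y)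

/-- The generator `ŷ`. -/
def yh : Func q X := mk q X (FreeAlgebra.ι ℂ .yh)

theorem y_mul_fn (f : ℝˣ → ℂ) : y q X * fn q X f = fn q X (fun x => f (q ^ 2 * x)) * y q X := by
  have h := mk_rel q X (FuncRel.y_fn f)
  rw [map_mul, map_mul] at h
  exact h

theorem yh_mul_fn (f : ℝˣ → ℂ) :
    yh q X * fn q X f = fn q X (fun x => f (q⁻¹ ^ 2 * x)) * yh q X := by
  have h := mk_rel q X (FuncRel.yh_fn f)
  rw [map_mul, map_mul] at h
  exact h

theorem yh_mul_y : yh q X * y q X = fn q X (fun x => -X.poly ((q⁻¹ * x : ℝˣ) : ℝ)) := by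
  have h := mk_rel q X FuncRel.yh_y
  rw [map_mul] at h
  exact h

theorem y_mul_yh : y q X * yh q X = fn q X (fun x => -X.poly ((q * x : ℝˣ) : ℝ)) := by
  have h := mk_rel q X FuncRel.y_yh
  rw [map_mul] at h
  exact h

variable {q X} in
theorem algHom_ext {B : Type*} [Ring B] [Algebra ℂ B] {φ ψ : Func q X →ₐ[ℂ] B}
    (hf : ∀ f, φ (fn q X f) = ψ (fn q X f)) (hy : φ (y q X) = ψ (y q X))
    (hyh : φ (yh q X) = ψ (yh q X)) : φ = ψ := by
  apply RingQuot.ringQuot_ext'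
  apply FreeAlgebra.hom_ext
  funext g
  cases g with
  | fn f => exact hf f
  | y => exact hy
  | yh => exact hyh

/-- The universal property of the algebra of functions on a quantum hyperboloid. -/
def lift {B : Type*} [Ring B] [Algebra ℂ B] (φ : (ℝˣ → ℂ) →ₐ[ℂ] B) (b b' : B)
    (h₁ : ∀ f : ℝˣ → ℂ, b * φ f = φ (fun x => f (q ^ 2 * x)) * b)
    (h₂ : ∀ f : ℝˣ → ℂ, b' * φ f = φ (fun x => f (q⁻¹ ^ 2 * x)) * b')
    (h₃ : b' * b = φ (fun x => -X.poly ((q⁻¹ * x : ℝˣ) : ℝ)))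
    (h₄ : b * b' = φ (fun x => -X.poly ((q * x : ℝˣ) : ℝ))) : Func q X →ₐ[ℂ] B :=
  RingQuot.liftAlgHom ℂ
    ⟨FreeAlgebra.lift ℂ (fun g => match g with | .fn f => φ f | .y => b | .yh => b'), by
      intro a a' ha
      cases ha with
      | fn_const a =>
        simp only [FreeAlgebra.lift_ι_apply, AlgHom.commutes]
        exact φ.commutes a
      | fn_add f g => simp
      | fn_mul f g => simp
      | y_fn f => simp [h₁]
      | yh_fn f => simp [h₂]
      | yh_y => simp [h₃]
      | y_yh => simp [h₄]⟩

theorem lift_fn {B : Type*} [Ring B] [Algebra ℂ B] {φ : (ℝˣ → ℂ) →ₐ[ℂ] B} {b b' : B}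
    (h₁ h₂ h₃ h₄) (f : ℝˣ → ℂ) : lift q X φ b b' h₁ h₂ h₃ h₄ (fn q X f) = φ f := by
  change lift q X φ b b' h₁ h₂ h₃ h₄ (mk q X (FreeAlgebra.ι ℂ (.fn f))) = φ f
  simp only [lift, mk]
  erw [RingQuot.liftAlgHom_mkAlgHom_apply]
  simp

theorem lift_y {B : Type*} [Ring B] [Algebra ℂ B] {φ : (ℝˣ → ℂ) →ₐ[ℂ] B} {b b' : B}
    (h₁ h₂ h₃ h₄) : lift q X φ b b' h₁ h₂ h₃ h₄ (y q X) = b := by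
  simp only [lift, y, mk]
  erw [RingQuot.liftAlgHom_mkAlgHom_apply]
  simp

theorem lift_yh {B : Type*} [Ring B] [Algebra ℂ B] {φ : (ℝˣ → ℂ) →ₐ[ℂ] B} {b b' : B}
    (h₁ h₂ h₃ h₄) : lift q X φ b b' h₁ h₂ h₃ h₄ (yh q X) = b' := by
  simp only [lift, yh, mk]
  erw [RingQuot.liftAlgHom_mkAlgHom_apply]
  simp

/-- `f(x)* = (conj f)(x)`. -/
def starFn : (ℝˣ → ℂ) →ₐ[ℂ] ConjOp (Func q X) where
  toFun f := toConjOp (fn q X (fun x => conj (f x)))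
  map_one' := ofConjOp_injective (by
    rw [ofConjOp_toConjOp, ofConjOp_one, ← map_one (fn q X)]
    congr 1
    funext x
    simp)
  map_mul' f g := ofConjOp_injective (by
    rw [ofConjOp_mul]
    simp only [ofConjOp_toConjOp]
    rw [← map_mul]
    congr 1
    funext x
    simp [mul_comm])
  map_zero' := ofConjOp_injective (by
    rw [ofConjOp_toConjOp, ofConjOp_zero, ← map_zero (fn q X)]
    congr 1
    funext x
    simp)
  map_add' f g := ofConjOp_injective (by
    rw [ofConjOp_add]
    simp only [ofConjOp_toConjOp]
    rw [← map_add]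
    congr 1
    funext x
    simp)
  commutes' a := ofConjOp_injective (by
    rw [ofConjOp_toConjOp, ofConjOp_algebraMap, ← AlgHom.commutes (fn q X)]
    congr 1)

theorem ofConjOp_starFn (f : ℝˣ → ℂ) :
    ofConjOp (starFn q X f) = fn q X (fun x => conj (f x)) := rfl

/-- The conjugate-linear anti-endomorphism with `f(x) ↦ (conj f)(x)`, `y ↦ -ŷ`, `ŷ ↦ -y`. -/
def starHom : Func q X →ₐ[ℂ] ConjOp (Func q X) :=
  lift q X (starFn q X) (toConjOp (-yh q X)) (toConjOp (-y q X))
    (fun f => ofConjOp_injective (by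
      rw [ofConjOp_mul, ofConjOp_mul, ofConjOp_starFn, ofConjOp_starFn, ofConjOp_toConjOp,
        neg_mul, mul_neg, yh_mul_fn]
      simp [← mul_assoc]))
    (fun f => ofConjOp_injective (by
      rw [ofConjOp_mul, ofConjOp_mul, ofConjOp_starFn, ofConjOp_starFn, ofConjOp_toConjOp,
        neg_mul, mul_neg, y_mul_fn]
      simp [← mul_assoc]))
    (ofConjOp_injective (by
      rw [ofConjOp_mul, ofConjOp_starFn, ofConjOp_toConjOp, ofConjOp_toConjOp, neg_mul_neg,
        yh_mul_y]
      simp only [map_neg, X.conj_poly]))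
    (ofConjOp_injective (by
      rw [ofConjOp_mul, ofConjOp_starFn, ofConjOp_toConjOp, ofConjOp_toConjOp, neg_mul_neg,
        y_mul_yh]
      simp only [map_neg, X.conj_poly]))

theorem ofConjOp_starHom_fn (f : ℝˣ → ℂ) :
    ofConjOp (starHom q X (fn q X f)) = fn q X (fun x => conj (f x)) := by
  rw [starHom, lift_fn, ofConjOp_starFn]

theorem ofConjOp_starHom_y : ofConjOp (starHom q X (y q X)) = -yh q X := by
  rw [starHom, lift_y, ofConjOp_toConjOp]

theorem ofConjOp_starHom_yh : ofConjOp (starHom q X (yh q X)) = -y q X := by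
  rw [starHom, lift_yh, ofConjOp_toConjOp]

theorem starHom_sq : conjSquare (starHom q X) = AlgHom.id ℂ (Func q X) := by
  apply algHom_ext
  · intro f
    change ofConjOp (starHom q X (ofConjOp (starHom q X (fn q X f)))) = fn q X f
    rw [ofConjOp_starHom_fn, ofConjOp_starHom_fn]
    simp
  · change ofConjOp (starHom q X (ofConjOp (starHom q X (y q X)))) = y q X
    rw [ofConjOp_starHom_y, map_neg, ofConjOp_neg, ofConjOp_starHom_yh, neg_neg]
  · change ofConjOp (starHom q X (ofConjOp (starHom q X (yh q X)))) = yh q X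
    rw [ofConjOp_starHom_yh, map_neg, ofConjOp_neg, ofConjOp_starHom_y, neg_neg]

/-- The involution of the algebra of functions on the quantum hyperboloid:
`f(x)* = (conj f)(x)`, `y* = -ŷ`, `ŷ* = -y`. -/
instance : StarRing (Func q X) := starRingOf (starHom q X) (starHom_sq q X)

instance : StarModule ℂ (Func q X) := starModuleOf (starHom q X) (starHom_sq q X)

theorem star_fn (f : ℝˣ → ℂ) : star (fn q X f) = fn q X (fun x => conj (f x)) :=
  ofConjOp_starHom_fn q X f

theorem star_y : star (y q X) = -yh q X := ofConjOp_starHom_y q X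

theorem star_yh : star (yh q X) = -y q X := ofConjOp_starHom_yh q X

end Func

end Func

/-! ### The quantum moment map -/

section MomentMap

/-- The normalization constant `q^(1/2) / (q⁻¹ - q)`. -/
def momentConst (q : ℝˣ) : ℝ := √(q : ℝ) / ((q : ℝ)⁻¹ - (q : ℝ))

theorem momentConst_sq {q : ℝˣ} (hq : 0 < (q : ℝ) ∧ (q : ℝ) < 1) :
    (momentConst q : ℂ) * momentConst q * (((q : ℝ) : ℂ)⁻¹ ^ 2 - 1) =
      (((q : ℝ) : ℂ)⁻¹ - (q : ℝ))⁻¹ := by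
  have h1 : (q : ℝ)⁻¹ - (q : ℝ) ≠ 0 := by
    have : 1 < (q : ℝ)⁻¹ := (one_lt_inv₀ hq.1).2 hq.2
    linarith [hq.2]
  have h2 : momentConst q * momentConst q * ((q : ℝ)⁻¹ ^ 2 - 1) = ((q : ℝ)⁻¹ - (q : ℝ))⁻¹ := by
    have h3 : (q : ℝ)⁻¹ ^ 2 - 1 = (q : ℝ)⁻¹ * ((q : ℝ)⁻¹ - (q : ℝ)) := by
      field_simp
    have h4 : √(q : ℝ) * √(q : ℝ) = q := Real.mul_self_sqrt hq.1.le
    have h5 : (q : ℝ) ≠ 0 := hq.1.ne'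
    rw [momentConst, h3, div_mul_div_comm, h4]
    generalize (q : ℝ)⁻¹ - (q : ℝ) = t at h1 ⊢
    field_simp
  exact_mod_cast h2

theorem sign_sq (s : ℤˣ) : ((s : ℤ) : ℂ) * ((s : ℤ) : ℂ) = 1 := by
  rcases Int.units_eq_one_or s with rfl | rfl <;> simp

theorem sign_ne_zero (s : ℤˣ) : ((s : ℤ) : ℂ) ≠ 0 := by
  rcases Int.units_eq_one_or s with rfl | rfl <;> simp

/-- The quantum moment map `J : U_q su(1,1) → Func(X_{c₀,d₀})_q`,
`E ↦ q^(1/2) / (q⁻¹ - q) · (c₀ d₀)^(-1/2) y`, `F ↦ q^(1/2) / (q⁻¹ - q) · x⁻¹ ŷ`,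
`K ↦ (c₀ d₀)^(-1/2) x`, where `s = ±1` is the chosen square root of `c₀ d₀ = 1`. -/
def J (q : ℝˣ) (hq : 0 < (q : ℝ) ∧ (q : ℝ) < 1) (X : Hyperboloid) (s : ℤˣ) :
    Uq q →ₐ[ℂ] Func q X :=
  Uq.lift q
    ((((s : ℤ) : ℂ) * momentConst q) • Func.y q X)
    ((momentConst q : ℂ) • (Func.fn q X (fun x => ((x : ℝ) : ℂ)⁻¹) * Func.yh q X))
    (Func.fn q X (fun x => ((s : ℤ) : ℂ) * ((x : ℝ) : ℂ)))
    (Func.fn q X (fun x => (((s : ℤ) : ℂ) * ((x : ℝ) : ℂ))⁻¹))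
    (by
      rw [← map_mul, ← map_one (Func.fn q X)]
      congr 1
      funext x
      have hs := sign_ne_zero s
      have hx : ((x : ℝ) : ℂ) ≠ 0 := by simp
      simp only [Pi.mul_apply, Pi.one_apply]
      field_simp)
    (by
      rw [← map_mul, ← map_one (Func.fn q X)]
      congr 1
      funext x
      have hs := sign_ne_zero s
      have hx : ((x : ℝ) : ℂ) ≠ 0 := by simp
      simp only [Pi.mul_apply, Pi.one_apply]
      field_simp)
    (by
      have hq0 : ((q : ℝ) : ℂ) ≠ 0 := by simp
      have h : (fun x : ℝˣ => ((s : ℤ) : ℂ) * ((x : ℝ) : ℂ)) = ((q : ℝ) : ℂ)⁻¹ ^ 2 •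
          (fun x : ℝˣ => ((s : ℤ) : ℂ) * (((q ^ 2 * x : ℝˣ) : ℝ) : ℂ)) := by
        funext x
        simp only [Pi.smul_apply, smul_eq_mul, Units.val_mul, Units.val_pow_eq_pow_val]
        push_cast
        field_simp
      rw [smul_mul_assoc, mul_smul_comm, Func.y_mul_fn]
      conv_lhs => rw [h, map_smul, smul_mul_assoc]
      rw [smul_comm])
    (by
      have hq0 : ((q : ℝ) : ℂ) ≠ 0 := by simp
      have h : (fun x : ℝˣ => ((s : ℤ) : ℂ) * ((x : ℝ) : ℂ)) = ((q : ℝ) : ℂ) ^ 2 •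
          (fun x : ℝˣ => ((s : ℤ) : ℂ) * (((q⁻¹ ^ 2 * x : ℝˣ) : ℝ) : ℂ)) := by
        funext x
        simp only [Pi.smul_apply, smul_eq_mul, Units.val_mul, Units.val_pow_eq_pow_val,
          Units.val_inv_eq_inv_val]
        push_cast
        field_simp
      rw [smul_mul_assoc, mul_smul_comm, mul_assoc, Func.yh_mul_fn]
      conv_lhs => rw [h, map_smul, smul_mul_assoc]
      rw [smul_comm, ← mul_assoc, ← mul_assoc, ← map_mul, ← map_mul, mul_comm])
    (by
      rw [smul_mul_smul_comm, smul_mul_smul_comm, ← mul_assoc, Func.y_mul_fn, mul_assoc (Func.fn q X _),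
        mul_assoc (Func.fn q X _), Func.y_mul_yh, Func.yh_mul_y, ← map_mul, ← map_mul, ← map_sub,
        ← map_smul, ← map_smul, ← map_smul, ← map_sub]
      congr 1
      funext x
      have hq0 : ((q : ℝ) : ℂ) ≠ 0 := by simp
      have hx : ((x : ℝ) : ℂ) ≠ 0 := by simp
      have hs := sign_ne_zero s
      have hs2 := sign_sq s
      have hsi : ((s : ℤ) : ℂ)⁻¹ = ((s : ℤ) : ℂ) := inv_eq_of_mul_eq_one_left hs2
      simp only [Pi.smul_apply, Pi.mul_apply, Pi.sub_apply, smul_eq_mul, Units.val_mul,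
        Units.val_pow_eq_pow_val, Units.val_inv_eq_inv_val, Hyperboloid.poly, ← momentConst_sq hq,
        mul_inv, hsi]
      push_cast
      have hcd := X.mul_eq_one
      generalize (momentConst q : ℂ) = a
      generalize ((s : ℤ) : ℂ) = t
      generalize ((x : ℝ) : ℂ) = z at hx ⊢
      generalize ((q : ℝ) : ℂ) = p at hq0 ⊢
      field_simp
      linear_combination (a ^ 2 * t * (p ^ 2 - 1)) * hcd)

theorem J_E (q : ℝˣ) (hq : 0 < (q : ℝ) ∧ (q : ℝ) < 1) (X : Hyperboloid) (s : ℤˣ) :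
    J q hq X s (Uq.E q) = (((s : ℤ) : ℂ) * momentConst q) • Func.y q X := by
  rw [J, Uq.lift_E]

theorem J_F (q : ℝˣ) (hq : 0 < (q : ℝ) ∧ (q : ℝ) < 1) (X : Hyperboloid) (s : ℤˣ) :
    J q hq X s (Uq.F q) =
      (momentConst q : ℂ) • (Func.fn q X (fun x => ((x : ℝ) : ℂ)⁻¹) * Func.yh q X) := by
  rw [J, Uq.lift_F]

theorem J_K (q : ℝˣ) (hq : 0 < (q : ℝ) ∧ (q : ℝ) < 1) (X : Hyperboloid) (s : ℤˣ) :
    J q hq X s (Uq.K q) = Func.fn q X (fun x => ((s : ℤ) : ℂ) * ((x : ℝ) : ℂ)) := by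
  rw [J, Uq.lift_K]

theorem J_Ki (q : ℝˣ) (hq : 0 < (q : ℝ) ∧ (q : ℝ) < 1) (X : Hyperboloid) (s : ℤˣ) :
    J q hq X s (Uq.Ki q) = Func.fn q X (fun x => (((s : ℤ) : ℂ) * ((x : ℝ) : ℂ))⁻¹) := by
  rw [J, Uq.lift_Ki]

/-- `J` is a homomorphism of `*`-algebras. -/
theorem J_star (q : ℝˣ) (hq : 0 < (q : ℝ) ∧ (q : ℝ) < 1) (X : Hyperboloid) (s : ℤˣ) (a : Uq q) :
    J q hq X s (star a) = star (J q hq X s a) := by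
  let φ : Uq q →ₐ[ℂ] ConjOp (Func q X) := (Func.starHom q X).comp (J q hq X s)
  let ψ : Uq q →ₐ[ℂ] ConjOp (Func q X) := (conjMap (J q hq X s)).comp (Uq.starHom q)
  have hφ : ∀ b, ofConjOp (φ b) = star (J q hq X s b) := fun _ => rfl
  have hψ : ∀ b, ofConjOp (ψ b) = J q hq X s (star b) := fun _ => rfl
  have hst : ∀ r : ℝ, star (r : ℂ) = r := fun r => Complex.conj_ofReal r
  have hsg : star (((s : ℤ) : ℂ)) = ((s : ℤ) : ℂ) := by
    rcases Int.units_eq_one_or s with rfl | rfl <;> simp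
  have hs := sign_ne_zero s
  have hq0 : ((q : ℝ) : ℂ) ≠ 0 := by simp
  have key : ψ = φ := by
    apply Uq.algHom_ext
    · apply ofConjOp_injective
      rw [hφ, hψ, Uq.star_E, map_neg, map_mul, J_E, J_K, J_F, star_smul, star_mul', Func.star_y,
        hst, hsg, smul_neg, mul_smul_comm, ← mul_assoc, ← map_mul]
      have h : ((fun x : ℝˣ => ((s : ℤ) : ℂ) * ((x : ℝ) : ℂ)) * fun x : ℝˣ => ((x : ℝ) : ℂ)⁻¹) =
          algebraMap ℂ (ℝˣ → ℂ) ((s : ℤ) : ℂ) := by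
        funext x
        simp
      rw [h, AlgHom.commutes, ← Algebra.smul_def, smul_smul, mul_comm]
    · apply ofConjOp_injective
      rw [hφ, hψ, Uq.star_F, map_neg, map_mul, J_E, J_Ki, J_F, star_smul, star_mul, Func.star_fn,
        Func.star_yh, hst, neg_mul, smul_neg, smul_mul_assoc, Func.y_mul_fn, Func.y_mul_fn,
        mul_comm, ← smul_smul, ← smul_mul_assoc, ← map_smul]
      congr 4
      funext x
      have hx : ((x : ℝ) : ℂ) ≠ 0 := by simp
      simp
      field_simp
    · apply ofConjOp_injective
      rw [hφ, hψ, Uq.star_K, J_K, Func.star_fn]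
      congr 1
      funext x
      simp
    · apply ofConjOp_injective
      rw [hφ, hψ, Uq.star_Ki, J_Ki, Func.star_fn]
      congr 1
      funext x
      simp
  rw [← hψ, ← hφ, key]

end MomentMap

/-! ### `*`-representations -/

section Representations

variable {A : Type*} [Ring A] [Algebra ℂ A] [Star A]
variable {V : Type*} [NormedAddCommGroup V] [InnerProductSpace ℂ V]

open UniformSpace

/-- A `*`-representation of `A` on the pre-Hilbert space `V`, acting in the Hilbert space that is
the completion of `V`: the scalar product satisfies `(a v, w) = (v, a* w)`, and every operator of
the representation, as a densely defined operator in the completion, has a closed extension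
(that is, the closure of its graph contains no `(0, z)` with `z ≠ 0`). -/
structure IsStarRep (ρ : A →ₐ[ℂ] Module.End ℂ V) : Prop where
  inner_map : ∀ (a : A) (v w : V), inner ℂ (ρ a v) w = inner ℂ v (ρ (star a) w)
  closable : ∀ (a : A) (z : Completion V),
    ((0 : Completion V), z) ∈ closure
      (Set.range fun v : V => ((v : Completion V), ((ρ a v : V) : Completion V))) → z = 0

/-- Irreducibility of a `*`-representation in the Hilbert space completion of `V`: every bounded
operator that commutes (weakly) with the representation is a scalar. -/
def IsIrreducibleRep (ρ : A →ₐ[ℂ] Module.End ℂ V) : Prop :=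
  Nontrivial V ∧ ∀ T : Completion V →L[ℂ] Completion V,
    (∀ (a : A) (v w : V), inner ℂ (T ((ρ a v : V) : Completion V)) (w : Completion V) =
      inner ℂ (T (v : Completion V)) ((ρ (star a) w : V) : Completion V)) →
    ∃ z : ℂ, ∀ v : Completion V, T v = z • v

/-- Simplicity of the underlying module. -/
def IsSimpleRep {A : Type*} [Ring A] [Algebra ℂ A] (ρ : A →ₐ[ℂ] Module.End ℂ V) : Prop :=
  Nontrivial V ∧ ∀ W : Submodule ℂ V, (∀ (a : A), ∀ w ∈ W, ρ a w ∈ W) → W = ⊥ ∨ W = ⊤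

end Representations

/-! ### Induced modules over the algebra of functions -/

section Induced

/-- The left ideal of `Func` generated by all `f(x) - f(ν₀)`. -/
def inducedIdeal (q : ℝˣ) (X : Hyperboloid) (ν : ℝˣ) : Submodule (Func q X) (Func q X) :=
  Submodule.span (Func q X)
    (Set.range fun f : ℝˣ → ℂ => Func.fn q X f - algebraMap ℂ (Func q X) (f ν))

/-- The module `Π_ν` induced from the character `f(x) ↦ f(ν₀)` of the commutative subalgebra of all
`f(x)`: it is generated by one vector `1_ν` subject to `f(x) 1_ν = f(ν₀) 1_ν`. -/
abbrev InducedModule (q : ℝˣ) (X : Hyperboloid) (ν : ℝˣ) : Type :=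
  Func q X ⧸ inducedIdeal q X ν

/-- The module of `π` is a quotient of the induced module `Π_ν` (in particular, it may be `Π_ν`
itself). -/
def IsQuotientOfInduced {q : ℝˣ} {X : Hyperboloid} {V : Type*} [AddCommGroup V] [Module ℂ V]
    (ν : ℝˣ) (π : Func q X →ₐ[ℂ] Module.End ℂ V) : Prop :=
  ∃ φ : InducedModule q X ν →ₗ[ℂ] V, Function.Surjective φ ∧
    ∀ (a : Func q X) (p : InducedModule q X ν), φ (a • p) = π a (φ p)

/-- The geometric progression `{ν₀ q^(2k) : k ∈ ℤ}`. -/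
def progression (q ν : ℝˣ) : Set ℝ :=
  Set.range fun k : ℤ => (ν : ℝ) * (q : ℝ) ^ (2 * k)

end Induced

/-! ### The series of irreducible `*`-representations of `U_q su(1,1)` -/

section Series

variable {q : ℝˣ} {V : Type*} [NormedAddCommGroup V] [InnerProductSpace ℂ V]

/-- The value `(q^l - q^(-l)) (q^(l+1) - q^(-l-1)) / (q⁻¹ - q)²` of the Casimir element in the
representations of spin `l`. -/
def casimirValue (q : ℝˣ) (l : ℂ) : ℂ :=
  (((q : ℝ) : ℂ) ^ l - ((q : ℝ) : ℂ) ^ (-l)) * (((q : ℝ) : ℂ) ^ (l + 1) - ((q : ℝ) : ℂ) ^ (-l - 1)) /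
    (((q : ℝ) : ℂ)⁻¹ - ((q : ℝ) : ℂ)) ^ 2

/-- `ρ` is an irreducible `*`-representation of `U_q su(1,1)` of spin `l` and parity `ε`:
`|ε| ≤ 1/2`, the Casimir element acts by `casimirValue q l`, and `K` is diagonalizable with all
eigenvalues of the form `q^(2(k+ε))`, `k ∈ ℤ`. -/
structure HasSpinParity (ρ : Uq q →ₐ[ℂ] Module.End ℂ V) (l : ℂ) (ε : ℝ) : Prop where
  isStarRep : IsStarRep ρ
  irreducible : IsIrreducibleRep ρ
  abs_parity_le : |ε| ≤ 1 / 2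
  casimir_eq : ∀ v : V, ρ (Uq.casimir q) v = casimirValue q l • v
  K_diagonalizable : ⨆ μ : ℂ, (ρ (Uq.K q)).eigenspace μ = ⊤
  K_eigenvalue : ∀ μ : ℂ, (ρ (Uq.K q)).HasEigenvalue μ →
    ∃ k : ℤ, μ = (((q : ℝ) ^ (2 * ((k : ℝ) + ε)) : ℝ) : ℂ)

/-- All the numbers `q^(2(k+ε))`, `k ∈ ℤ`, are eigenvalues of `K`. -/
def HasAllWeights (ρ : Uq q →ₐ[ℂ] Module.End ℂ V) (ε : ℝ) : Prop :=
  ∀ k : ℤ, (ρ (Uq.K q)).HasEigenvalue (((q : ℝ) ^ (2 * ((k : ℝ) + ε)) : ℝ) : ℂ)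

/-- Principal continuous series: `l = -1/2 + iτ` with `τ` real. -/
def IsPrincipalSeries (ρ : Uq q →ₐ[ℂ] Module.End ℂ V) : Prop :=
  ∃ τ ε : ℝ, HasSpinParity ρ (-1 / 2 + τ * Complex.I) ε ∧ HasAllWeights ρ ε

/-- Complementary series: `-1/2 < l < 0`, `|ε| < |l|`. -/
def IsComplementarySeries (ρ : Uq q →ₐ[ℂ] Module.End ℂ V) : Prop :=
  ∃ l ε : ℝ, -1 / 2 < l ∧ l < 0 ∧ |ε| < |l| ∧ HasSpinParity ρ l ε ∧ HasAllWeights ρ ε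

/-- Strange series: `Im l = π / (2 log q)`, that is, `q^(2l+1)` is negative. -/
def IsStrangeSeries (ρ : Uq q →ₐ[ℂ] Module.End ℂ V) : Prop :=
  ∃ (l : ℂ) (ε : ℝ), l.im = Real.pi / (2 * Real.log (q : ℝ)) ∧
    HasSpinParity ρ l ε ∧ HasAllWeights ρ ε

/-- Holomorphic discrete series: `l` is real, `l - ε ∈ ℤ`, and the eigenvalues of `K` are
`q^(2(l+1+k))`, `k = 0, 1, 2, …` (so that there is a highest weight vector, annihilated by `E`). -/
def IsHolomorphicSeries (ρ : Uq q →ₐ[ℂ] Module.End ℂ V) : Prop :=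
  ∃ l ε : ℝ, (∃ n : ℤ, l - ε = n) ∧ HasSpinParity ρ l ε ∧
    ∀ μ : ℂ, (ρ (Uq.K q)).HasEigenvalue μ ↔
      ∃ k : ℕ, μ = (((q : ℝ) ^ (2 * (l + 1 + (k : ℝ))) : ℝ) : ℂ)

/-- Anti-holomorphic discrete series: `l` is real, `l + ε ∈ ℤ`, and the eigenvalues of `K` are
`q^(-2(l+1+k))`, `k = 0, 1, 2, …` (so that there is a lowest weight vector, annihilated by `F`). -/
def IsAntiholomorphicSeries (ρ : Uq q →ₐ[ℂ] Module.End ℂ V) : Prop :=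
  ∃ l ε : ℝ, (∃ n : ℤ, l + ε = n) ∧ HasSpinParity ρ l ε ∧
    ∀ μ : ℂ, (ρ (Uq.K q)).HasEigenvalue μ ↔
      ∃ k : ℕ, μ = (((q : ℝ) ^ (-2 * (l + 1 + (k : ℝ))) : ℝ) : ℂ)

end Series

end QuantumOrbit

end

open QuantumOrbit

namespace QuantumOrbit

/-! The moment map misses only functions of `x` that are not obtained from `K`, so the point is to
recover every `f(x)` from polynomials in `K`. In a `*`-representation this can be done one vector at
a time: all functions of `x`, however large, act on a given `v`, and this forces `v` to have finite
support in `x` (`finitelySupported`). On a finite set `f` is interpolated by a polynomial in `K`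
(`exists_J_eq_on`), so invariant subspaces and weak commutants are the same for the two algebras.

Finite support also splits `V` algebraically into weight spaces of `x`, which are eigenspaces of
`K`. A quotient of `Π_ν` is spanned by the vectors `y^n v` and `ŷ^n v`, of weights `q^(∓2n) ν₀`. The
weight space of `ν₀` is therefore a line, and since `v` is cyclic the commutant is scalar
(`IsCyclicWeightVector.isIrreducibleRep`).

The Casimir element goes to the scalar `(s(c₀ + d₀) - q - q⁻¹) / (q⁻¹ - q)²` (`J_casimir`), so the
spin is any `l` with `q^(2l+1) = s c₀`. The weights are found from `‖y v‖² = (q⁻¹t - c₀)(q⁻¹t - d₀)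
‖v‖²` on weight `t` and its analogue for `ŷ`: the progression is two-sided if no root is met, and is
cut at `q c₀` or `q⁻¹ d₀` in the discrete series. What remains is to compare exponents of `q`. -/

theorem Func.induction {q : ℝˣ} {X : Hyperboloid} {p : Func q X → Prop}
    (fn : ∀ f, p (Func.fn q X f)) (y : p (Func.y q X)) (yh : p (Func.yh q X))
    (add : ∀ a b, p a → p b → p (a + b)) (mul : ∀ a b, p a → p b → p (a * b))
    (a : Func q X) : p a := by
  obtain ⟨w, rfl⟩ := RingQuot.mkAlgHom_surjective ℂ (FuncRel q X) a
  induction w using FreeAlgebra.induction with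
  | grade0 r =>
    have h : RingQuot.mkAlgHom ℂ (FuncRel q X) (algebraMap ℂ _ r) =
        Func.fn q X (algebraMap ℂ _ r) := by
      rw [AlgHom.commutes, AlgHom.commutes]; rfl
    rw [h]
    exact fn _
  | grade1 g =>
    cases g with
    | fn f => exact fn f
    | y => exact y
    | yh => exact yh
  | mul a b ha hb => rw [map_mul]; exact mul _ _ ha hb
  | add a b ha hb => rw [map_add]; exact add _ _ ha hb

/-! ### Finite support of vectors with respect to `x`. -/

section FiniteSupport

variable {q : ℝˣ} {X : Hyperboloid} {V : Type*} [NormedAddCommGroup V] [InnerProductSpace ℂ V]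
  {π : Func q X →ₐ[ℂ] Module.End ℂ V}

theorem inner_fn (hπ : IsStarRep π) (f : ℝˣ → ℂ) (v w : V) :
    inner ℂ (π (Func.fn q X f) v) w = inner ℂ v (π (Func.fn q X fun x => conj (f x)) w) := by
  rw [hπ.inner_map, Func.star_fn]

theorem fn_fn (f g : ℝˣ → ℂ) (v : V) :
    π (Func.fn q X f) (π (Func.fn q X g) v) = π (Func.fn q X (f * g)) v := by
  rw [map_mul, map_mul, Module.End.mul_apply]

theorem fn_const (r : ℂ) (v : V) : π (Func.fn q X fun _ => r) v = r • v := by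
  have h : (Func.fn q X fun _ => r) = algebraMap ℂ (Func q X) r :=
    AlgHom.commutes (Func.fn q X) r
  rw [h, AlgHom.commutes, Module.algebraMap_end_apply]

theorem fn_add (f g : ℝˣ → ℂ) (v : V) :
    π (Func.fn q X (f + g)) v = π (Func.fn q X f) v + π (Func.fn q X g) v := by
  rw [map_add, map_add, LinearMap.add_apply]

/-- Complete `h` by `g = √(C² - |h|²)`: from `|h|² + |g|² = C²` one gets `‖h(x)v‖² + ‖g(x)v‖² =
C²‖v‖²`. -/
theorem norm_fn_le (hπ : IsStarRep π) {h : ℝˣ → ℂ} {C : ℝ} (hC : ∀ x, ‖h x‖ ≤ C) (v : V) :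
    ‖π (Func.fn q X h) v‖ ≤ C * ‖v‖ := by
  have hC0 : 0 ≤ C := (norm_nonneg _).trans (hC 1)
  let g : ℝˣ → ℂ := fun x => (√(C ^ 2 - ‖h x‖ ^ 2) : ℝ)
  have key : inner ℂ (π (Func.fn q X h) v) (π (Func.fn q X h) v) +
      inner ℂ (π (Func.fn q X g) v) (π (Func.fn q X g) v) = (C : ℂ) ^ 2 * inner ℂ v v := by
    rw [inner_fn hπ, inner_fn hπ, fn_fn, fn_fn, ← inner_add_right, ← fn_add, ← inner_smul_right,
      ← fn_const (π := π)]
    congr 4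
    funext x
    have h1 : 0 ≤ C ^ 2 - ‖h x‖ ^ 2 := by
      have := hC x
      have := norm_nonneg (h x)
      nlinarith
    have h2 : conj (h x) * h x = ((‖h x‖ ^ 2 : ℝ) : ℂ) := by
      rw [mul_comm, Complex.mul_conj, Complex.normSq_eq_norm_sq]
    have h3 : conj (g x) * g x = ((C ^ 2 - ‖h x‖ ^ 2 : ℝ) : ℂ) := by
      simp only [g, Complex.conj_ofReal]
      rw [← Complex.ofReal_mul, Real.mul_self_sqrt h1]
    simp only [Pi.add_apply, Pi.mul_apply]
    rw [h2, h3]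
    push_cast
    ring
  rw [inner_self_eq_norm_sq_to_K, inner_self_eq_norm_sq_to_K, inner_self_eq_norm_sq_to_K] at key
  have key2 : ‖π (Func.fn q X h) v‖ ^ 2 + ‖π (Func.fn q X g) v‖ ^ 2 = C ^ 2 * ‖v‖ ^ 2 := by
    exact Complex.ofReal_injective (by push_cast; exact key)
  apply le_of_sq_le_sq _ (by positivity)
  nlinarith [sq_nonneg ‖π (Func.fn q X g) v‖]

open Classical in
/-- A decreasing sequence of sets with empty intersection is eventually null for a vector. -/
theorem exists_null_of_iInter_eq_empty (hπ : IsStarRep π) (v : V) (A : ℕ → Set ℝˣ)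
    (hA : Antitone A) (h0 : ∀ x, ∃ n, x ∉ A n) :
    ∃ n, π (Func.fn q X ((A n).indicator 1)) v = 0 := by
  by_contra! hne
  -- The `a k` are chosen so that a function `f` with `f ≥ a n` on `A n` for every `n` would give
  -- `‖f(x)v‖ ≥ n` for every `n`. Such an `f` is the sum of the `a k` over those `k` for which the
  -- point is still in `A k`.
  let a : ℕ → ℝ := fun k => k / ‖π (Func.fn q X ((A k).indicator 1)) v‖
  have ha : ∀ k, 0 ≤ a k := fun k => by positivity
  let f : ℝˣ → ℂ := fun x => ((∑ k ∈ Finset.range (Nat.find (h0 x)), a k : ℝ) : ℂ)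
  obtain ⟨n, hn⟩ := exists_nat_gt (‖π (Func.fn q X f) v‖)
  have hn0 : 0 < n := by
    rcases Nat.eq_zero_or_pos n with rfl | h
    · exact absurd hn (by simp)
    · exact h
  have hpos : 0 < ‖π (Func.fn q X ((A n).indicator 1)) v‖ := norm_pos_iff.2 (hne n)
  have han : 0 < a n := by positivity
  have hf : ∀ x ∈ A n, a n ≤ ∑ k ∈ Finset.range (Nat.find (h0 x)), a k := by
    intro x hx
    apply Finset.single_le_sum (fun k _ => ha k)
    rw [Finset.mem_range, Nat.lt_find_iff]
    intro m hm hxm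
    exact hxm (hA hm hx)
  -- Dividing by `f` on `A n` turns the pointwise bound `f ≥ a n` into a bounded multiplier, to
  -- which `norm_fn_le` applies.
  let h : ℝˣ → ℂ := (A n).indicator fun x => (f x)⁻¹
  have hfh : (A n).indicator 1 = h * f := by
    funext x
    by_cases hx : x ∈ A n
    · have : f x ≠ 0 := by
        simp only [f]
        exact_mod_cast (han.trans_le (hf x hx)).ne'
      simp [h, hx, this]
    · simp [h, hx]
  have hle : ∀ x, ‖h x‖ ≤ (a n)⁻¹ := by
    intro x
    by_cases hx : x ∈ A n
    · have h1 := hf x hx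
      simp only [h, Set.indicator_of_mem hx, f, norm_inv, Complex.norm_real, Real.norm_eq_abs]
      rw [abs_of_pos (han.trans_le h1)]
      exact inv_anti₀ han h1
    · simp [h, hx, han.le]
  have h1 := norm_fn_le hπ hle (π (Func.fn q X f) v)
  rw [fn_fn, ← hfh] at h1
  have h2 : a n * ‖π (Func.fn q X ((A n).indicator 1)) v‖ = n := by
    simp only [a]
    field_simp
  have h3 : a n * ‖π (Func.fn q X ((A n).indicator 1)) v‖ ≤ ‖π (Func.fn q X f) v‖ := by
    calc _ ≤ a n * ((a n)⁻¹ * ‖π (Func.fn q X f) v‖) := by gcongr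
      _ = _ := by field_simp
  linarith

/-- The restriction of the vector `v` to the set `A` has finite support. -/
def FinitelySupportedOn (π : Func q X →ₐ[ℂ] Module.End ℂ V) (v : V) (A : Set ℝˣ) : Prop :=
  ∃ S : Finset ℝˣ, ∀ f : ℝˣ → ℂ, (∀ x, f x ≠ 0 → x ∈ A ∧ x ∉ S) → π (Func.fn q X f) v = 0

open Classical in
theorem FinitelySupportedOn.of_inter {v : V} {A B : Set ℝˣ}
    (h₁ : FinitelySupportedOn π v (A ∩ B)) (h₂ : FinitelySupportedOn π v (A ∩ Bᶜ)) :
    FinitelySupportedOn π v A := by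
  obtain ⟨S, hS⟩ := h₁
  obtain ⟨T, hT⟩ := h₂
  refine ⟨S ∪ T, fun f hf => ?_⟩
  rw [← Set.indicator_self_add_compl B f, fn_add, hS, hT, add_zero]
  · intro x hx
    have hx' := Set.mem_of_indicator_ne_zero hx
    rw [Set.indicator_of_mem hx'] at hx
    have := hf x hx
    simp_all
  · intro x hx
    have hx' := Set.mem_of_indicator_ne_zero hx
    rw [Set.indicator_of_mem hx'] at hx
    have := hf x hx
    simp_all

/-- Bisection: if `v` is not finitely supported on a set, it is not finitely supported on one of the
two pieces cut off by a rational point. Running through all rationals gives nested bad sets whose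
intersection has at most one point, and without that point they are eventually null for `v`. -/
theorem finitelySupported (hπ : IsStarRep π) (v : V) : FinitelySupportedOn π v Set.univ := by
  by_contra hbad
  let e : ℚ → Set ℝˣ := fun r => {x | (r : ℝ) < x}
  obtain ⟨d, hd⟩ := exists_surjective_nat ℚ
  have step : ∀ (n : ℕ) (A : {A : Set ℝˣ // ¬ FinitelySupportedOn π v A}),
      ∃ B : {A : Set ℝˣ // ¬ FinitelySupportedOn π v A},
        B.1 = A.1 ∩ e (d n) ∨ B.1 = A.1 ∩ (e (d n))ᶜ := by
    intro n A
    by_contra! hB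
    apply A.2
    apply FinitelySupportedOn.of_inter (B := e (d n))
    · by_contra h
      exact (hB ⟨_, h⟩).1 rfl
    · by_contra h
      exact (hB ⟨_, h⟩).2 rfl
  choose g hg using step
  let A : ℕ → {A : Set ℝˣ // ¬ FinitelySupportedOn π v A} := fun n =>
    Nat.rec ⟨Set.univ, hbad⟩ (fun n A => g n A) n
  have hAs : ∀ n, (A (n + 1)).1 = (A n).1 ∩ e (d n) ∨ (A (n + 1)).1 = (A n).1 ∩ (e (d n))ᶜ :=
    fun n => hg n (A n)
  have hanti : Antitone fun n => (A n).1 := by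
    apply antitone_nat_of_succ_le
    intro n
    rcases hAs n with h | h <;> rw [h] <;> exact Set.inter_subset_left
  have hsub : (⋂ n, (A n).1).Subsingleton := by
    intro x hx y hy
    by_contra hxy
    rw [Set.mem_iInter] at hx hy
    have aux : ∀ x y : ℝˣ, (∀ n, x ∈ (A n).1) → (∀ n, y ∈ (A n).1) → ¬ (x : ℝ) < y := by
      intro x y hx hy hlt
      obtain ⟨r, hr1, hr2⟩ := exists_rat_btwn hlt
      obtain ⟨n, rfl⟩ := hd r
      have h1 := hx (n + 1)
      have h2 := hy (n + 1)
      rcases hAs n with h | h <;> rw [h] at h1 h2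
      · exact lt_asymm hr1 h1.2
      · exact h2.2 hr2
    apply hxy
    apply Units.ext
    exact le_antisymm (not_lt.1 (aux y x hy hx)) (not_lt.1 (aux x y hx hy))
  obtain ⟨n, hn⟩ := exists_null_of_iInter_eq_empty hπ v (fun n => (A n).1 \ ⋂ n, (A n).1)
    (fun m n hmn => Set.sdiff_subset_sdiff_left (hanti hmn)) (by
      intro x
      by_contra! h
      exact (h 0).2 (Set.mem_iInter.2 fun n => (h n).1))
  apply (A n).2
  -- The exceptional set is the intersection of all `A n`, which is empty or a single point; off it,
  -- `A n` is null for `v`.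
  refine ⟨hsub.finite.toFinset, fun f hf => ?_⟩
  have h : f = f * ((A n).1 \ ⋂ n, (A n).1).indicator 1 := by
    funext x
    by_cases hx : f x = 0
    · simp [hx]
    · have h1 := hf x hx
      rw [Set.Finite.mem_toFinset] at h1
      have : x ∈ (A n).1 \ ⋂ n, (A n).1 := h1
      rw [Pi.mul_apply, Set.indicator_of_mem this, Pi.one_apply, mul_one]
  rw [h, ← fn_fn, hn, map_zero]

theorem exists_support (hπ : IsStarRep π) (v : V) :
    ∃ S : Finset ℝˣ, ∀ f g : ℝˣ → ℂ, (∀ x ∈ S, f x = g x) →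
      π (Func.fn q X f) v = π (Func.fn q X g) v := by
  obtain ⟨S, hS⟩ := finitelySupported hπ v
  refine ⟨S, fun f g hfg => ?_⟩
  rw [← sub_eq_zero, ← LinearMap.sub_apply, ← map_sub, ← map_sub]
  apply hS
  intro x hx
  refine ⟨trivial, fun hxS => hx ?_⟩
  rw [Pi.sub_apply, hfg x hxS, sub_self]

end FiniteSupport

/-! ### Recovering functions of `x` from the image of the moment map. -/

theorem momentConst_ne_zero {q : ℝˣ} (hq : 0 < (q : ℝ) ∧ (q : ℝ) < 1) :
    (momentConst q : ℂ) ≠ 0 := by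
  have h1 : 1 < (q : ℝ)⁻¹ := (one_lt_inv₀ hq.1).2 hq.2
  have h2 : 0 < momentConst q := div_pos (Real.sqrt_pos.2 hq.1) (by linarith [hq.2])
  exact_mod_cast h2.ne'

/-- The algebra of functions is generated by all `f(x)` and the image of the moment map. -/
theorem Func.induction_moment {q : ℝˣ} (hq : 0 < (q : ℝ) ∧ (q : ℝ) < 1) {X : Hyperboloid}
    (s : ℤˣ) {p : Func q X → Prop} (fn : ∀ f, p (Func.fn q X f)) (moment : ∀ a, p (J q hq X s a))
    (add : ∀ a b, p a → p b → p (a + b)) (mul : ∀ a b, p a → p b → p (a * b))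
    (a : Func q X) : p a := by
  have hm := momentConst_ne_zero hq
  have smul : ∀ (r : ℂ) a, p a → p (r • a) := by
    intro r a ha
    rw [Algebra.smul_def, ← AlgHom.commutes (Func.fn q X)]
    exact mul _ _ (fn _) ha
  apply Func.induction fn _ _ add mul
  · have h := smul (((s : ℤ) : ℂ) * momentConst q)⁻¹ _ (moment (Uq.E q))
    rwa [J_E, inv_smul_smul₀ (mul_ne_zero (sign_ne_zero s) hm)] at h
  -- The factor `x⁻¹` in the image of `F` is removed by multiplying by the function `x`.
  · have h := smul (momentConst q : ℂ)⁻¹ _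
      (mul _ _ (fn fun x => ((x : ℝ) : ℂ)) (moment (Uq.F q)))
    rw [J_F, mul_smul_comm, inv_smul_smul₀ hm, ← mul_assoc, ← map_mul] at h
    convert h
    rw [← one_mul (Func.yh q X), ← map_one (Func.fn q X), ← mul_assoc, ← map_mul]
    congr 2
    funext x
    simp

theorem J_aeval_K {q : ℝˣ} (hq : 0 < (q : ℝ) ∧ (q : ℝ) < 1) {X : Hyperboloid} (s : ℤˣ)
    (p : Polynomial ℂ) : J q hq X s (Polynomial.aeval (Uq.K q) p) =
      Func.fn q X fun x => p.eval (((s : ℤ) : ℂ) * ((x : ℝ) : ℂ)) := by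
  rw [← Polynomial.aeval_algHom_apply, J_K, Polynomial.aeval_algHom_apply]
  congr 1
  funext x
  rw [Polynomial.aeval_pi_apply]
  change Polynomial.aeval _ p = _
  rw [Polynomial.coe_aeval_eq_eval]

/-- A function of `x` is interpolated by polynomials in `K` on every finite set. -/
theorem exists_J_eq_on {q : ℝˣ} (hq : 0 < (q : ℝ) ∧ (q : ℝ) < 1) (X : Hyperboloid) (s : ℤˣ)
    (f : ℝˣ → ℂ) (S : Finset ℝˣ) :
    ∃ (a : Uq q) (g : ℝˣ → ℂ), J q hq X s a = Func.fn q X g ∧ ∀ x ∈ S, f x = g x := by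
  classical
  refine ⟨_, _, J_aeval_K hq s
    (Lagrange.interpolate S (fun x : ℝˣ => ((s : ℤ) : ℂ) * ((x : ℝ) : ℂ)) f), fun x hx => ?_⟩
  rw [Lagrange.eval_interpolate_at_node f (v := fun x : ℝˣ => ((s : ℤ) : ℂ) * ((x : ℝ) : ℂ)) _ hx]
  intro x _ y _ hxy
  have := mul_left_cancel₀ (sign_ne_zero s) hxy
  exact Units.ext (by exact_mod_cast this)

/-! ### Transfer of simplicity and irreducibility along the moment map. -/

section Transfer

variable {q : ℝˣ} (hq : 0 < (q : ℝ) ∧ (q : ℝ) < 1) {X : Hyperboloid}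
  {V : Type*} [NormedAddCommGroup V] [InnerProductSpace ℂ V]
  {π : Func q X →ₐ[ℂ] Module.End ℂ V}

theorem IsStarRep.comp_J (hπ : IsStarRep π) (s : ℤˣ) : IsStarRep (π.comp (J q hq X s)) where
  inner_map a v w := by
    simp only [AlgHom.comp_apply]
    rw [hπ.inner_map, J_star]
  closable a := hπ.closable (J q hq X s a)

/-- An invariant subspace of `U_q su(1,1)` is invariant under every `f(x)`, since on each of its
vectors `f(x)` agrees with a polynomial in `K`. The polynomial may depend on the vector. -/
theorem IsSimpleRep.comp_J (hπ : IsStarRep π) (s : ℤˣ) (h : IsSimpleRep π) :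
    IsSimpleRep (π.comp (J q hq X s)) := by
  refine ⟨h.1, fun W hW => h.2 W fun a => ?_⟩
  induction a using Func.induction_moment hq s with
  | fn f =>
    intro w hw
    obtain ⟨S, hS⟩ := exists_support hπ w
    obtain ⟨a, g, ha, hg⟩ := exists_J_eq_on hq X s f S
    rw [hS f g hg, ← ha]
    exact hW a w hw
  | moment a => exact hW a
  | add a b ha hb =>
    intro w hw
    rw [map_add, LinearMap.add_apply]
    exact W.add_mem (ha w hw) (hb w hw)
  | mul a b ha hb =>
    intro w hw
    rw [map_mul, Module.End.mul_apply]
    exact ha _ (hb w hw)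

theorem IsIrreducibleRep.comp_J (hπ : IsStarRep π) (s : ℤˣ) (h : IsIrreducibleRep π) :
    IsIrreducibleRep (π.comp (J q hq X s)) := by
  classical
  refine ⟨h.1, fun T hT => h.2 T fun a => ?_⟩
  induction a using Func.induction_moment hq s with
  | fn f =>
    intro v w
    obtain ⟨S, hS⟩ := exists_support hπ v
    obtain ⟨S', hS'⟩ := exists_support hπ w
    -- The relation involves `f(x)` on `v` and its adjoint on `w`, so one polynomial must
    -- interpolate on both supports.
    obtain ⟨a, g, ha, hg⟩ := exists_J_eq_on hq X s f (S ∪ S')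
    have h := hT a v w
    rw [AlgHom.comp_apply, AlgHom.comp_apply, J_star, ha, Func.star_fn] at h
    rw [Func.star_fn, hS f g fun x hx => hg x (Finset.mem_union_left _ hx), h,
      hS' (fun x => conj (f x)) (fun x => conj (g x))]
    intro x hx
    rw [hg x (Finset.mem_union_right _ hx)]
  | moment a =>
    intro v w
    rw [← J_star]
    exact hT a v w
  | add a b ha hb =>
    intro v w
    simp only [star_add, map_add, LinearMap.add_apply, UniformSpace.Completion.coe_add,
      inner_add_left, inner_add_right, ha, hb]
  | mul a b ha hb =>
    intro v w
    simp only [star_mul, map_mul, Module.End.mul_apply, ha, hb]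

end Transfer

/-! ### The Casimir element and the spin. -/

theorem J_casimir {q : ℝˣ} (hq : 0 < (q : ℝ) ∧ (q : ℝ) < 1) (X : Hyperboloid) (s : ℤˣ) :
    J q hq X s (Uq.casimir q) = algebraMap ℂ (Func q X)
      ((((s : ℤ) : ℂ) * (X.c + X.d) - (q : ℝ) - ((q : ℝ) : ℂ)⁻¹) /
        (((q : ℝ) : ℂ)⁻¹ - (q : ℝ)) ^ 2) := by
  have hm : (momentConst q : ℂ) * momentConst q =
      (q : ℝ) / (((q : ℝ) : ℂ)⁻¹ - (q : ℝ)) ^ 2 := by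
    have : momentConst q * momentConst q = (q : ℝ) / ((q : ℝ)⁻¹ - (q : ℝ)) ^ 2 := by
      rw [momentConst, div_mul_div_comm, Real.mul_self_sqrt hq.1.le, pow_two]
    exact_mod_cast this
  have hnum : J q hq X s 2 = Func.fn q X 2 := by rw [map_ofNat, map_ofNat]
  rw [Uq.casimir, map_add, map_smul, map_smul, map_add, map_add, map_sub, map_mul, map_mul, hnum,
    J_E, J_F, J_K, J_Ki, smul_mul_smul_comm, smul_mul_smul_comm, ← mul_assoc, Func.y_mul_fn,
    mul_assoc (Func.fn q X _), mul_assoc (Func.fn q X _), Func.y_mul_yh, Func.yh_mul_y,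
    ← map_mul, ← map_mul, ← map_sub, ← map_add, ← map_smul, ← map_smul, ← map_add, ← map_smul,
    ← map_smul, ← map_add, ← AlgHom.commutes (Func.fn q X)]
  congr 1
  funext x
  have hq0 : ((q : ℝ) : ℂ) ≠ 0 := by simp
  have hx : ((x : ℝ) : ℂ) ≠ 0 := by simp
  have hs2 := sign_sq s
  have hsi : ((s : ℤ) : ℂ)⁻¹ = ((s : ℤ) : ℂ) := inv_eq_of_mul_eq_one_left hs2
  have hm1 : ((s : ℤ) : ℂ) * momentConst q * momentConst q =
      ((s : ℤ) : ℂ) * ((q : ℝ) / (((q : ℝ) : ℂ)⁻¹ - (q : ℝ)) ^ 2) := by rw [mul_assoc, hm]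
  have hm2 : (momentConst q : ℂ) * (((s : ℤ) : ℂ) * momentConst q) =
      ((s : ℤ) : ℂ) * ((q : ℝ) / (((q : ℝ) : ℂ)⁻¹ - (q : ℝ)) ^ 2) := by rw [← hm]; ring
  rw [hm1, hm2]
  simp only [Pi.smul_apply, Pi.mul_apply, Pi.sub_apply, Pi.add_apply, smul_eq_mul, Units.val_mul,
    Units.val_pow_eq_pow_val, Units.val_inv_eq_inv_val, Hyperboloid.poly, mul_inv, hsi,
    Pi.ofNat_apply, Pi.algebraMap_apply, Algebra.algebraMap_self, RingHom.id_apply]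
  push_cast
  have hcd := X.mul_eq_one
  generalize ((s : ℤ) : ℂ) = t
  generalize ((x : ℝ) : ℂ) = z at hx ⊢
  simp only [div_eq_mul_inv, mul_inv]
  generalize ((((q : ℝ) : ℂ)⁻¹ - (q : ℝ)) ^ 2)⁻¹ = D
  generalize ((q : ℝ) : ℂ) = p at hq0 ⊢
  field_simp
  linear_combination (-t * D * (p ^ 2 + 1)) * hcd

/-- The numerator expands to `q^(2l+1) + q^(-2l-1) - q - q⁻¹`, and `q^(-2l-1) = s d₀` because `s² =
c₀ d₀ = 1`. -/
theorem casimirValue_eq {q : ℝˣ} (X : Hyperboloid) (s : ℤˣ) {l : ℂ}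
    (hl : ((q : ℝ) : ℂ) ^ (2 * l + 1) = ((s : ℤ) : ℂ) * X.c) :
    casimirValue q l = (((s : ℤ) : ℂ) * (X.c + X.d) - (q : ℝ) - ((q : ℝ) : ℂ)⁻¹) /
        (((q : ℝ) : ℂ)⁻¹ - (q : ℝ)) ^ 2 := by
  have hq0 : ((q : ℝ) : ℂ) ≠ 0 := by simp
  rw [casimirValue]
  congr 1
  have e1 : -l - 1 = -(l + 1) := by ring
  have e2 : 2 * l + 1 = l + (l + 1) := by ring
  rw [e2, Complex.cpow_add _ _ hq0, Complex.cpow_add _ _ hq0, Complex.cpow_one] at hl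
  rw [e1, Complex.cpow_neg, Complex.cpow_neg, Complex.cpow_add _ _ hq0, Complex.cpow_one]
  have ha : ((q : ℝ) : ℂ) ^ l ≠ 0 := by simp [Complex.cpow_eq_zero_iff]
  generalize ((q : ℝ) : ℂ) ^ l = a at *
  generalize ((q : ℝ) : ℂ) = p at *
  have hs := sign_ne_zero s
  have hs2 := sign_sq s
  have hd : ((s : ℤ) : ℂ) * X.d = (a * (a * p))⁻¹ := by
    rw [hl]
    apply eq_inv_of_mul_eq_one_left
    linear_combination X.mul_eq_one * ((s : ℤ) : ℂ) * ((s : ℤ) : ℂ) + hs2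
  rw [mul_add, hd, ← hl]
  field_simp
  ring

/-! ### Weights of `x` and the action of `y`, `ŷ` on weight vectors. -/

section Weights

variable {q : ℝˣ} {X : Hyperboloid} {V : Type*} [NormedAddCommGroup V] [InnerProductSpace ℂ V]
  {π : Func q X →ₐ[ℂ] Module.End ℂ V}

/-- All `f(x)` act on `v` by `f(t)`. -/
def IsWeightVector (π : Func q X →ₐ[ℂ] Module.End ℂ V) (t : ℝˣ) (v : V) : Prop :=
  ∀ f, π (Func.fn q X f) v = f t • v

/-- The point `t` is a weight of the module. -/
def HasWeight (π : Func q X →ₐ[ℂ] Module.End ℂ V) (t : ℝˣ) : Prop :=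
  ∃ v, v ≠ 0 ∧ IsWeightVector π t v

namespace IsWeightVector

variable {t : ℝˣ} {v : V}

theorem y (h : IsWeightVector π t v) : IsWeightVector π (q⁻¹ ^ 2 * t) (π (Func.y q X) v) := by
  intro f
  have h1 := Func.y_mul_fn q X fun x => f (q⁻¹ ^ 2 * x)
  simp only [inv_pow, inv_mul_cancel_left] at h1
  rw [← Module.End.mul_apply, ← map_mul, ← h1, map_mul, Module.End.mul_apply, h, map_smul, inv_pow]

theorem yh (h : IsWeightVector π t v) : IsWeightVector π (q ^ 2 * t) (π (Func.yh q X) v) := by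
  intro f
  have h1 := Func.yh_mul_fn q X fun x => f (q ^ 2 * x)
  simp only [inv_pow, mul_inv_cancel_left] at h1
  rw [← Module.End.mul_apply, ← map_mul, ← h1, map_mul, Module.End.mul_apply, h, map_smul]

theorem yh_y (h : IsWeightVector π t v) : π (Func.yh q X) (π (Func.y q X) v) =
    -X.poly ((q⁻¹ * t : ℝˣ) : ℝ) • v := by
  rw [← Module.End.mul_apply, ← map_mul, Func.yh_mul_y, h]

theorem y_yh (h : IsWeightVector π t v) : π (Func.y q X) (π (Func.yh q X) v) =
    -X.poly ((q * t : ℝˣ) : ℝ) • v := by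
  rw [← Module.End.mul_apply, ← map_mul, Func.y_mul_yh, h]

theorem inner_y (hπ : IsStarRep π) (h : IsWeightVector π t v) :
    inner ℂ (π (Func.y q X) v) (π (Func.y q X) v) =
      X.poly ((q⁻¹ * t : ℝˣ) : ℝ) * inner ℂ v v := by
  rw [hπ.inner_map, Func.star_y, map_neg, LinearMap.neg_apply, h.yh_y, ← neg_smul, neg_neg,
    inner_smul_right]

theorem inner_yh (hπ : IsStarRep π) (h : IsWeightVector π t v) :
    inner ℂ (π (Func.yh q X) v) (π (Func.yh q X) v) =
      X.poly ((q * t : ℝˣ) : ℝ) * inner ℂ v v := by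
  rw [hπ.inner_map, Func.star_yh, map_neg, LinearMap.neg_apply, h.y_yh, ← neg_smul, neg_neg,
    inner_smul_right]

/-- This truncates the progression: at a root of `X.poly` the relations only give `ŷ y v = 0`, and
it is positivity of the scalar product that kills `y v` itself. -/
theorem y_eq_zero (hπ : IsStarRep π) (h : IsWeightVector π t v)
    (h0 : X.poly ((q⁻¹ * t : ℝˣ) : ℝ) = 0) : π (Func.y q X) v = 0 := by
  rw [← inner_self_eq_zero (𝕜 := ℂ), h.inner_y hπ, h0, zero_mul]

theorem yh_eq_zero (hπ : IsStarRep π) (h : IsWeightVector π t v)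
    (h0 : X.poly ((q * t : ℝˣ) : ℝ) = 0) : π (Func.yh q X) v = 0 := by
  rw [← inner_self_eq_zero (𝕜 := ℂ), h.inner_yh hπ, h0, zero_mul]

theorem y_pow (h : IsWeightVector π t v) (n : ℕ) :
    IsWeightVector π ((q⁻¹ ^ 2) ^ n * t) ((π (Func.y q X) ^ n) v) := by
  induction n with
  | zero => simpa using h
  | succ n ih =>
    rw [pow_succ' (π (Func.y q X)), Module.End.mul_apply, pow_succ', mul_assoc]
    exact ih.y

theorem yh_pow (h : IsWeightVector π t v) (n : ℕ) :
    IsWeightVector π ((q ^ 2) ^ n * t) ((π (Func.yh q X) ^ n) v) := by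
  induction n with
  | zero => simpa using h
  | succ n ih =>
    rw [pow_succ' (π (Func.yh q X)), Module.End.mul_apply, pow_succ', mul_assoc]
    exact ih.yh

end IsWeightVector

theorem HasWeight.y {t : ℝˣ} (h : HasWeight π t) (h0 : X.poly ((q⁻¹ * t : ℝˣ) : ℝ) ≠ 0) :
    HasWeight π (q⁻¹ ^ 2 * t) := by
  obtain ⟨v, hv, h⟩ := h
  refine ⟨_, fun h1 => ?_, h.y⟩
  have h2 := h.yh_y
  rw [h1, map_zero, eq_comm, smul_eq_zero] at h2
  exact h2.elim (neg_ne_zero.2 h0) hv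

theorem HasWeight.yh {t : ℝˣ} (h : HasWeight π t) (h0 : X.poly ((q * t : ℝˣ) : ℝ) ≠ 0) :
    HasWeight π (q ^ 2 * t) := by
  obtain ⟨v, hv, h⟩ := h
  refine ⟨_, fun h1 => ?_, h.yh⟩
  have h2 := h.y_yh
  rw [h1, map_zero, eq_comm, smul_eq_zero] at h2
  exact h2.elim (neg_ne_zero.2 h0) hv

/-- The delta function at `t` acts as the projection onto the weight space of `t`, since multiplying
it by `f` scales it by `f(t)`. -/
theorem isWeightVector_single [DecidableEq ℝˣ] (t : ℝˣ) (v : V) :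
    IsWeightVector π t (π (Func.fn q X (Pi.single t 1)) v) := by
  intro f
  rw [fn_fn, ← LinearMap.smul_apply, ← map_smul, ← map_smul]
  congr 3
  funext x
  by_cases hx : x = t
  · subst hx
    simp
  · simp [hx]

/-- On the finite support of `v` the constant `1` equals a finite sum of delta functions. -/
theorem exists_sum_single [DecidableEq ℝˣ] (hπ : IsStarRep π) (v : V) :
    ∃ S : Finset ℝˣ, v = ∑ t ∈ S, π (Func.fn q X (Pi.single t 1)) v := by
  obtain ⟨S, hS⟩ := exists_support hπ v
  refine ⟨S, ?_⟩
  rw [← LinearMap.sum_apply, ← map_sum, ← map_sum]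
  rw [← hS 1]
  · rw [map_one, map_one, Module.End.one_apply]
  · intro x hx
    rw [Finset.sum_apply, Finset.sum_pi_single, if_pos hx, Pi.one_apply]

theorem iSup_eigenspace_K (hπ : IsStarRep π) (hq : 0 < (q : ℝ) ∧ (q : ℝ) < 1) (s : ℤˣ) :
    ⨆ μ : ℂ, ((π.comp (J q hq X s)) (Uq.K q)).eigenspace μ = ⊤ := by
  classical
  rw [eq_top_iff]
  intro v _
  obtain ⟨S, hS⟩ := exists_sum_single hπ v
  rw [hS]
  refine Submodule.sum_mem _ fun t _ =>
    Submodule.mem_iSup_of_mem (((s : ℤ) : ℂ) * ((t : ℝ) : ℂ)) ?_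
  rw [Module.End.mem_eigenspace_iff, AlgHom.comp_apply, J_K, isWeightVector_single]

theorem hasEigenvalue_K_iff (hπ : IsStarRep π) (hq : 0 < (q : ℝ) ∧ (q : ℝ) < 1) (s : ℤˣ) (μ : ℂ) :
    ((π.comp (J q hq X s)) (Uq.K q)).HasEigenvalue μ ↔
      ∃ t, HasWeight π t ∧ μ = ((s : ℤ) : ℂ) * ((t : ℝ) : ℂ) := by
  classical
  constructor
  · intro h
    obtain ⟨v, hv⟩ := h.exists_hasEigenvector
    obtain ⟨S, hS⟩ := exists_sum_single hπ v
    obtain ⟨t, -, ht⟩ := Finset.exists_ne_zero_of_sum_ne_zero (hS ▸ hv.2)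
    refine ⟨t, ⟨_, ht, isWeightVector_single t v⟩, ?_⟩
    have h1 := hv.apply_eq_smul
    rw [AlgHom.comp_apply, J_K] at h1
    -- On the nonzero component of weight `t`, `K` acts both by `μ` and by `s t`.
    have h2 := isWeightVector_single (π := π) t v fun x => ((s : ℤ) : ℂ) * ((x : ℝ) : ℂ)
    rw [fn_fn, mul_comm, ← fn_fn, h1, map_smul] at h2
    exact smul_left_injective ℂ ht h2
  · rintro ⟨t, ⟨v, hv, h⟩, rfl⟩
    apply Module.End.hasEigenvalue_of_hasEigenvector (x := v)
    refine ⟨?_, hv⟩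
    rw [Module.End.mem_eigenspace_iff, AlgHom.comp_apply, J_K, h]

/-! ### Modules generated by one weight vector. -/

/-- A module generated by a weight vector. -/
structure IsCyclicWeightVector (π : Func q X →ₐ[ℂ] Module.End ℂ V) (ν : ℝˣ) (v : V) : Prop where
  weight : IsWeightVector π ν v
  cyclic : ∀ w, ∃ a, w = π a v

theorem IsQuotientOfInduced.exists_cyclic {ν : ℝˣ} (h : IsQuotientOfInduced ν π) :
    ∃ v, IsCyclicWeightVector π ν v := by
  obtain ⟨φ, hφ, hφa⟩ := h
  refine ⟨φ (Submodule.Quotient.mk 1), fun f => ?_, fun w => ?_⟩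
  · have h1 : (Func.fn q X f - algebraMap ℂ (Func q X) (f ν)) •
        (Submodule.Quotient.mk 1 : InducedModule q X ν) = 0 := by
      rw [← Submodule.Quotient.mk_smul, smul_eq_mul, mul_one, Submodule.Quotient.mk_eq_zero]
      exact Submodule.subset_span ⟨f, rfl⟩
    have h2 := hφa (Func.fn q X f - algebraMap ℂ (Func q X) (f ν)) (Submodule.Quotient.mk 1)
    rw [h1, map_zero, map_sub, LinearMap.sub_apply, AlgHom.commutes, Module.algebraMap_end_apply,
      eq_comm, sub_eq_zero] at h2
    exact h2
  · obtain ⟨p, rfl⟩ := hφ w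
    obtain ⟨a, rfl⟩ := Submodule.Quotient.mk_surjective _ p
    refine ⟨a, ?_⟩
    rw [← hφa, ← Submodule.Quotient.mk_smul, smul_eq_mul, mul_one]

namespace IsCyclicWeightVector

variable {ν : ℝˣ} {v : V}

theorem ne_zero [Nontrivial V] (h : IsCyclicWeightVector π ν v) : v ≠ 0 := by
  rintro rfl
  obtain ⟨w, hw⟩ := exists_ne (0 : V)
  obtain ⟨a, ha⟩ := h.cyclic w
  exact hw (ha.trans (map_zero _))

theorem hasWeight [Nontrivial V] (h : IsCyclicWeightVector π ν v) : HasWeight π ν :=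
  ⟨v, h.ne_zero, h.weight⟩

/-- A submodule containing all `y^n v` and `ŷ^n v` is everything. -/
theorem eq_top (h : IsCyclicWeightVector π ν v) (U : Submodule ℂ V)
    (hy : ∀ n, (π (Func.y q X) ^ n) v ∈ U) (hyh : ∀ n, (π (Func.yh q X) ^ n) v ∈ U) : U = ⊤ := by
  let W : Submodule ℂ V := Submodule.span ℂ
    (Set.range (fun n : ℕ => (π (Func.y q X) ^ n) v) ∪
      Set.range (fun n : ℕ => (π (Func.yh q X) ^ n) v))
  have hWy : ∀ n, (π (Func.y q X) ^ n) v ∈ W := fun n =>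
    Submodule.subset_span (Or.inl ⟨n, rfl⟩)
  have hWyh : ∀ n, (π (Func.yh q X) ^ n) v ∈ W := fun n =>
    Submodule.subset_span (Or.inr ⟨n, rfl⟩)
  have hWU : W ≤ U := by
    rw [Submodule.span_le]
    rintro _ (⟨n, rfl⟩ | ⟨n, rfl⟩)
    exacts [hy n, hyh n]
  have stable : ∀ L : Module.End ℂ V, (∀ n, L ((π (Func.y q X) ^ n) v) ∈ W) →
      (∀ n, L ((π (Func.yh q X) ^ n) v) ∈ W) → ∀ w ∈ W, L w ∈ W := by
    intro L h1 h2 w hw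
    have : W ≤ W.comap L := by
      rw [Submodule.span_le]
      rintro _ (⟨n, rfl⟩ | ⟨n, rfl⟩)
      exacts [h1 n, h2 n]
    exact this hw
  -- Each of `y`, `ŷ` prolongs one chain and steps back along the other; the step back stays in `W`
  -- because `ŷ y` and `y ŷ` are functions of `x`, hence scalars on weight vectors.
  have key : ∀ a : Func q X, ∀ w ∈ W, π a w ∈ W := by
    intro a
    induction a using Func.induction with
    | fn f =>
      apply stable
      · intro n
        rw [h.weight.y_pow]
        exact W.smul_mem _ (hWy n)
      · intro n
        rw [h.weight.yh_pow]
        exact W.smul_mem _ (hWyh n)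
    | y =>
      apply stable
      · intro n
        rw [← Module.End.mul_apply, ← pow_succ']
        exact hWy _
      · intro n
        cases n with
        | zero => simpa using hWy 1
        | succ n =>
          rw [pow_succ', Module.End.mul_apply, (h.weight.yh_pow n).y_yh]
          exact W.smul_mem _ (hWyh n)
    | yh =>
      apply stable
      · intro n
        cases n with
        | zero => simpa using hWyh 1
        | succ n =>
          rw [pow_succ', Module.End.mul_apply, (h.weight.y_pow n).yh_y]
          exact W.smul_mem _ (hWy n)
      · intro n
        rw [← Module.End.mul_apply, ← pow_succ']
        exact hWyh _
    | add a b ha hb =>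
      intro w hw
      rw [map_add, LinearMap.add_apply]
      exact W.add_mem (ha w hw) (hb w hw)
    | mul a b ha hb =>
      intro w hw
      rw [map_mul, Module.End.mul_apply]
      exact ha _ (hb w hw)
  rw [eq_top_iff]
  intro w _
  obtain ⟨a, rfl⟩ := h.cyclic w
  exact hWU (key a v (hWy 0))

/-- Otherwise the projection to weight `t` kills all the spanning vectors `y^n v`, `ŷ^n v`, hence
everything, although it fixes a nonzero vector of weight `t`. -/
theorem weight_cases (h : IsCyclicWeightVector π ν v) {t : ℝˣ} (ht : HasWeight π t) :
    (∃ n : ℕ, t = (q⁻¹ ^ 2) ^ n * ν ∧ (π (Func.y q X) ^ n) v ≠ 0) ∨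
      ∃ n : ℕ, t = (q ^ 2) ^ n * ν ∧ (π (Func.yh q X) ^ n) v ≠ 0 := by
  classical
  by_contra! hc
  obtain ⟨hy, hyh⟩ := hc
  have htop := h.eq_top (LinearMap.ker (π (Func.fn q X (Pi.single t 1)))) (fun n => by
    rw [LinearMap.mem_ker, h.weight.y_pow]
    by_cases htn : t = (q⁻¹ ^ 2) ^ n * ν
    · rw [hy n htn, smul_zero]
    · rw [Pi.single_eq_of_ne (Ne.symm htn), zero_smul]) (fun n => by
    rw [LinearMap.mem_ker, h.weight.yh_pow]
    by_cases htn : t = (q ^ 2) ^ n * ν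
    · rw [hyh n htn, smul_zero]
    · rw [Pi.single_eq_of_ne (Ne.symm htn), zero_smul])
  obtain ⟨w, hw, hwt⟩ := ht
  have : w ∈ LinearMap.ker (π (Func.fn q X (Pi.single t 1))) := htop ▸ Submodule.mem_top
  rw [LinearMap.mem_ker, hwt, Pi.single_eq_same, one_smul] at this
  exact hw this

theorem weight_eq_zpow (h : IsCyclicWeightVector π ν v) {t : ℝˣ} (ht : HasWeight π t) :
    ∃ k : ℤ, t = ν * q ^ (2 * k) := by
  rcases h.weight_cases ht with ⟨n, rfl, -⟩ | ⟨n, rfl, -⟩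
  · refine ⟨-n, ?_⟩
    rw [mul_comm, ← pow_mul, ← zpow_natCast, inv_zpow']
    push_cast
    ring_nf
  · refine ⟨n, ?_⟩
    rw [mul_comm, ← pow_mul, ← zpow_natCast]
    push_cast
    rfl

/-- The weight `ν` has multiplicity one: for `n ≠ 0` the weights `q^(∓2n) ν` of the other spanning
vectors differ from `ν`, as `q^(2n) < 1`. -/
theorem single_mem_span [DecidableEq ℝˣ] (hq : 0 < (q : ℝ) ∧ (q : ℝ) < 1)
    (h : IsCyclicWeightVector π ν v) (w : V) :
    π (Func.fn q X (Pi.single ν 1)) w ∈ Submodule.span ℂ {v} := by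
  have hne : ∀ n : ℕ, n ≠ 0 → (q ^ 2) ^ n ≠ 1 := by
    intro n hn h1
    have h2 : ((q : ℝ) ^ 2) ^ n = 1 := by
      simpa using congrArg Units.val h1
    exact (pow_lt_one₀ (by positivity) (pow_lt_one₀ hq.1.le hq.2 two_ne_zero) hn).ne h2
  have htop := h.eq_top ((Submodule.span ℂ {v}).comap (π (Func.fn q X (Pi.single ν 1))))
    (fun n => by
      rw [Submodule.mem_comap, h.weight.y_pow]
      rcases eq_or_ne n 0 with rfl | hn
      · simp
      · rw [Pi.single_eq_of_ne, zero_smul]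
        · exact Submodule.zero_mem _
        · rw [Ne, mul_eq_right, inv_pow, inv_pow, inv_eq_one]
          exact hne n hn) (fun n => by
      rw [Submodule.mem_comap, h.weight.yh_pow]
      rcases eq_or_ne n 0 with rfl | hn
      · simp
      · rw [Pi.single_eq_of_ne, zero_smul]
        · exact Submodule.zero_mem _
        · rw [Ne, mul_eq_right]
          exact hne n hn)
  have : w ∈ (Submodule.span ℂ {v}).comap (π (Func.fn q X (Pi.single ν 1))) :=
    htop ▸ Submodule.mem_top
  exact this

/-- An operator in the weak commutant commutes with the projection to the weight `ν`, so it sends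
`v` to a multiple `z v`. Since `v` is cyclic, it is `z` on `V`, and on the completion by continuity.
-/
theorem isIrreducibleRep [Nontrivial V] (hπ : IsStarRep π) (hq : 0 < (q : ℝ) ∧ (q : ℝ) < 1)
    (h : IsCyclicWeightVector π ν v) : IsIrreducibleRep π := by
  classical
  refine ⟨inferInstance, fun T hT => ?_⟩
  have hv := h.ne_zero
  have hvv : inner ℂ v v ≠ 0 := inner_self_ne_zero.2 hv
  let δ : ℝˣ → ℂ := Pi.single ν 1
  have hδ : (fun x => conj (δ x)) = δ := by
    funext x
    by_cases hx : x = ν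
    · subst hx; simp [δ]
    · simp [δ, hx]
  have hδv : π (Func.fn q X δ) v = v := by
    rw [h.weight]
    simp [δ]
  -- The conjugate appears because the scalar product is conjugate-linear in its first argument.
  let z : ℂ := conj (inner ℂ (T v) (v : UniformSpace.Completion V) / inner ℂ v v)
  have dense : ∀ x y : UniformSpace.Completion V,
      (∀ w : V, inner ℂ x (w : UniformSpace.Completion V) = inner ℂ y w) → x = y := by
    intro x y hxy
    apply ext_inner_right ℂ
    intro w
    induction w using UniformSpace.Completion.induction_on with
    | hp => exact isClosed_eq (continuous_const.inner continuous_id) (continuous_const.inner continuous_id)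
    | ih w => exact hxy w
  have hTv : T v = z • (v : UniformSpace.Completion V) := by
    apply dense
    intro w
    obtain ⟨r, hr⟩ := Submodule.mem_span_singleton.1 (h.single_mem_span hq w)
    have h1 := hT (Func.fn q X δ) v w
    rw [hδv, Func.star_fn, hδ, ← hr, UniformSpace.Completion.coe_smul, inner_smul_right] at h1
    have h2 := inner_fn hπ δ v w
    rw [hδv, hδ, ← hr, inner_smul_right] at h2
    rw [h1, inner_smul_left, UniformSpace.Completion.inner_coe, h2]
    simp only [z, Complex.conj_conj]
    field_simp
  refine ⟨z, fun x => ?_⟩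
  induction x using UniformSpace.Completion.induction_on with
  | hp => exact isClosed_eq T.continuous (continuous_const_smul z)
  | ih w =>
    obtain ⟨a, rfl⟩ := h.cyclic w
    apply dense
    intro w
    rw [hT, hTv, inner_smul_left, inner_smul_left, UniformSpace.Completion.inner_coe,
      UniformSpace.Completion.inner_coe, hπ.inner_map]

end IsCyclicWeightVector

theorem hasSpinParity_of_cyclic [Nontrivial V] (hπ : IsStarRep π)
    (hq : 0 < (q : ℝ) ∧ (q : ℝ) < 1) {ν : ℝˣ} {v : V} (h : IsCyclicWeightVector π ν v) (s : ℤˣ)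
    {l : ℂ} {ε : ℝ} (hε : |ε| ≤ 1 / 2)
    (hl : ((q : ℝ) : ℂ) ^ (2 * l + 1) = ((s : ℤ) : ℂ) * X.c)
    (hw : ∀ t, HasWeight π t → ∃ k : ℤ, ((s : ℤ) : ℝ) * t = (q : ℝ) ^ (2 * ((k : ℝ) + ε))) :
    HasSpinParity (π.comp (J q hq X s)) l ε where
  isStarRep := hπ.comp_J hq s
  irreducible := (h.isIrreducibleRep hπ hq).comp_J hq hπ s
  abs_parity_le := hε
  casimir_eq v := by
    rw [AlgHom.comp_apply, J_casimir, casimirValue_eq X s hl, AlgHom.commutes,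
      Module.algebraMap_end_apply]
  K_diagonalizable := iSup_eigenspace_K hπ hq s
  K_eigenvalue μ hμ := by
    obtain ⟨t, ht, rfl⟩ := (hasEigenvalue_K_iff hπ hq s μ).1 hμ
    obtain ⟨k, hk⟩ := hw t ht
    exact ⟨k, by rw [← hk]; push_cast; rfl⟩

end Weights

/-! ### Exponents of `q`: spin, parity and the complementary bound. -/

section Exponents

variable {q : ℝˣ}

theorem log_ne_zero (hq : 0 < (q : ℝ) ∧ (q : ℝ) < 1) : Real.log (q : ℝ) ≠ 0 := (Real.log_neg hq.1 hq.2).ne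

/-- Every positive number is a power of `q²`. -/
theorem exists_eq_rpow (hq : 0 < (q : ℝ) ∧ (q : ℝ) < 1) {x : ℝ} (hx : 0 < x) : ∃ a : ℝ, x = (q : ℝ) ^ (2 * a) := by
  refine ⟨Real.log x / (2 * Real.log q), ?_⟩
  have h := log_ne_zero hq
  rw [Real.rpow_def_of_pos hq.1]
  field_simp
  exact (Real.exp_log hx).symm

theorem exists_spin (hq : 0 < (q : ℝ) ∧ (q : ℝ) < 1) {x : ℝ} (hx : 0 < x) : ∃ l : ℝ, x = (q : ℝ) ^ (2 * l + 1) := by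
  obtain ⟨a, rfl⟩ := exists_eq_rpow hq hx
  exact ⟨a - 1 / 2, by ring_nf⟩

theorem exists_parity (hq : 0 < (q : ℝ) ∧ (q : ℝ) < 1) {x : ℝ} (hx : 0 < x) :
    ∃ (ε : ℝ) (k : ℤ), |ε| ≤ 1 / 2 ∧ x = (q : ℝ) ^ (2 * ((k : ℝ) + ε)) := by
  obtain ⟨a, rfl⟩ := exists_eq_rpow hq hx
  exact ⟨a - round a, round a, abs_sub_round a, by ring_nf⟩

theorem cpow_eq_exp (hq : 0 < (q : ℝ) ∧ (q : ℝ) < 1) (z : ℂ) : ((q : ℝ) : ℂ) ^ z = Complex.exp (Real.log q * z) := by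
  rw [Complex.cpow_def_of_ne_zero (by simp), Complex.ofReal_log hq.1.le]

theorem cpow_ofReal_spin (hq : 0 < (q : ℝ) ∧ (q : ℝ) < 1) {l c : ℝ} (h : c = (q : ℝ) ^ (2 * l + 1)) :
    ((q : ℝ) : ℂ) ^ (2 * (l : ℂ) + 1) = c := by
  rw [h, Complex.ofReal_cpow hq.1.le]
  push_cast
  rfl

theorem rpow_mul_zpow (hq : 0 < (q : ℝ) ∧ (q : ℝ) < 1) (a : ℝ) (k : ℤ) :
    (q : ℝ) ^ (2 * a) * (q : ℝ) ^ (2 * k) = (q : ℝ) ^ (2 * (a + k)) := by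
  rw [← Real.rpow_intCast, ← Real.rpow_add hq.1]
  push_cast
  ring_nf

theorem rpow_lt_rpow_iff (hq : 0 < (q : ℝ) ∧ (q : ℝ) < 1) {a b : ℝ} : (q : ℝ) ^ a < (q : ℝ) ^ b ↔ b < a :=
  Real.rpow_lt_rpow_left_iff_of_base_lt_one hq.1 hq.2

/-- If a positive progression avoids `[q c, q d]` for `c = q^(2l+1)`, `d = c⁻¹`, then `l` and the
parity satisfy the bounds of the complementary series. -/
theorem exists_complementary_parity (hq : 0 < (q : ℝ) ∧ (q : ℝ) < 1) {ν : ℝˣ} (hν : 0 < (ν : ℝ)) {c d l : ℝ}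
    (hc : c = (q : ℝ) ^ (2 * l + 1)) (hd : d = (q : ℝ) ^ (-(2 * l + 1)))
    (h1 : (q : ℝ) * c ∉ progression q ν) (h2 : (q : ℝ)⁻¹ * d ∉ progression q ν)
    (h3 : ∀ t ∈ progression q ν, t ∉ Set.Ioo ((q : ℝ) * c) ((q : ℝ) * d)) :
    ∃ (ε : ℝ) (k : ℤ), l < ε ∧ ε < -l ∧ (ν : ℝ) = (q : ℝ) ^ (2 * ((k : ℝ) + ε)) := by
  obtain ⟨a, ha⟩ := exists_eq_rpow hq hν
  have hqc : (q : ℝ) * c = (q : ℝ) ^ (2 * (l + 1)) := by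
    rw [hc]
    nth_rw 1 [← Real.rpow_one (q : ℝ)]
    rw [← Real.rpow_add hq.1]
    ring_nf
  have hqd : (q : ℝ) * d = (q : ℝ) ^ (2 * -l) := by
    rw [hd]
    nth_rw 1 [← Real.rpow_one (q : ℝ)]
    rw [← Real.rpow_add hq.1]
    ring_nf
  have hmem : ∀ k : ℤ, (q : ℝ) ^ (2 * (a + k)) ∈ progression q ν := fun k =>
    ⟨k, by simp only []; rw [ha, rpow_mul_zpow hq]⟩
  -- In exponents the progression is `a + ℤ`, and since `q < 1` the interval `(q c, q d)` becomes
  -- `(-l, l + 1)`. The endpoint `l + 1` is `q c`; the endpoint `-l` is excluded because `q d = q² ·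
  -- q⁻¹ d`.
  have avoid : ∀ k : ℤ, -l ≤ a + k → l + 1 < a + k := by
    intro k hk
    by_contra! hk2
    have hne1 : a + k ≠ l + 1 := fun h => h1 (by rw [hqc, ← h]; exact hmem k)
    have hne2 : a + k ≠ -l := by
      intro h
      apply h2
      have : (q : ℝ)⁻¹ * d = (q : ℝ) ^ (2 * (a + (k - 1 : ℤ))) := by
        rw [hd, ← Real.rpow_neg_one, ← Real.rpow_add hq.1]
        congr 1
        push_cast
        linarith
      rw [this]
      exact hmem _
    apply h3 _ (hmem k)
    rw [hqc, hqd, Set.mem_Ioo, rpow_lt_rpow_iff hq, rpow_lt_rpow_iff hq]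
    have e1 := lt_of_le_of_ne hk2 hne1
    have e2 := lt_of_le_of_ne hk hne2.symm
    constructor <;> linarith
  have hk1 := Int.le_ceil (-l - a)
  have hk2 := Int.ceil_lt_add_one (-l - a)
  have hk3 := avoid ⌈-l - a⌉ (by linarith)
  -- The first exponent of `a + ℤ` that is at least `-l` is below `1 - l`, and above `l + 1` by
  -- `avoid`. Lowering it by one gives a parity strictly between `l` and `-l`.
  refine ⟨a + ⌈-l - a⌉ - 1, 1 - ⌈-l - a⌉, by linarith, by linarith, ?_⟩
  rw [ha]
  push_cast
  ring_nf

end Exponents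

/-! ### Identification of the series. -/

section Series

variable {q : ℝˣ} {X : Hyperboloid} {V : Type*} [NormedAddCommGroup V] [InnerProductSpace ℂ V]
  {π : Func q X →ₐ[ℂ] Module.End ℂ V}

theorem HasWeight.mul_zpow {ν : ℝˣ} (h : HasWeight π ν)
    (h0 : ∀ k : ℤ, X.poly (q * (ν * q ^ (2 * k) : ℝˣ)) ≠ 0) (k : ℤ) :
    HasWeight π (ν * q ^ (2 * k)) := by
  induction k using Int.induction_on with
  | zero => simpa using h
  | succ k ih =>
    have h1 := ih.yh (by rw [Units.val_mul]; exact h0 _)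
    rwa [mul_left_comm, ← zpow_natCast, ← zpow_add, add_comm, Nat.cast_ofNat, ← mul_add_one] at h1
  | pred k ih =>
    -- The point `q⁻¹ t` that governs `y` at `t` is the point `q (q⁻² t)` that governs `ŷ` at the
    -- next weight, so one nonvanishing condition serves both directions.
    have e : (q⁻¹ * (ν * q ^ (2 * (-k : ℤ))) : ℝˣ) = q * (ν * q ^ (2 * (-k - 1 : ℤ))) := by
      rw [mul_sub_one, zpow_sub, mul_left_comm, mul_left_comm q]
      simp only [zpow_ofNat]
      group
    have h1 := ih.y (by rw [e, Units.val_mul]; exact h0 _)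
    rwa [mul_left_comm, inv_pow, ← zpow_natCast, ← zpow_neg, ← zpow_add,
      show (-(2 : ℕ) + 2 * -(k : ℤ) : ℤ) = 2 * (-k - 1) by push_cast; ring] at h1

theorem hasSpinParity_and_hasAllWeights [Nontrivial V] (hπ : IsStarRep π)
    (hq : 0 < (q : ℝ) ∧ (q : ℝ) < 1) {ν : ℝˣ} {v : V} (h : IsCyclicWeightVector π ν v)
    (h0 : ∀ k : ℤ, X.poly (q * (ν * q ^ (2 * k) : ℝˣ)) ≠ 0) (s : ℤˣ)
    {l : ℂ} {ε : ℝ} {m : ℤ} (hε : |ε| ≤ 1 / 2)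
    (hl : ((q : ℝ) : ℂ) ^ (2 * l + 1) = ((s : ℤ) : ℂ) * X.c)
    (hm : ((s : ℤ) : ℝ) * ν = (q : ℝ) ^ (2 * ((m : ℝ) + ε))) :
    HasSpinParity (π.comp (J q hq X s)) l ε ∧ HasAllWeights (π.comp (J q hq X s)) ε := by
  have hk : ∀ k : ℤ, ((s : ℤ) : ℝ) * (ν * q ^ (2 * k) : ℝˣ) =
      (q : ℝ) ^ (2 * (((m + k : ℤ) : ℝ) + ε)) := by
    intro k
    rw [Units.val_mul, ← mul_assoc, hm, Units.val_zpow_eq_zpow_val, rpow_mul_zpow hq]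
    push_cast
    ring_nf
  constructor
  · apply hasSpinParity_of_cyclic hπ hq h s hε hl
    intro t ht
    obtain ⟨k, rfl⟩ := h.weight_eq_zpow ht
    exact ⟨_, hk k⟩
  · intro k
    rw [hasEigenvalue_K_iff hπ]
    refine ⟨_, h.hasWeight.mul_zpow h0 (k - m), ?_⟩
    have := hk (k - m)
    rw [add_sub_cancel] at this
    rw [← this]
    push_cast
    rfl

theorem poly_ne_zero_of_real {c d : ℝ} (hc : X.c = c) (hd : X.d = d) {t : ℝ} (h1 : t ≠ c)
    (h2 : t ≠ d) : X.poly t ≠ 0 := by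
  rw [Hyperboloid.poly, hc, hd]
  exact mul_ne_zero (sub_ne_zero.2 (by exact_mod_cast h1)) (sub_ne_zero.2 (by exact_mod_cast h2))

/-- For `t` in the progression, `q t = c` would put `q c = q² t` in it, and `q t = d` would put `q⁻¹
d = t` in it. -/
theorem poly_ne_zero_of_not_mem_progression {c d : ℝ} (hc : X.c = c) (hd : X.d = d) {ν : ℝˣ}
    (h1 : (q : ℝ) * c ∉ progression q ν) (h2 : (q : ℝ)⁻¹ * d ∉ progression q ν) (k : ℤ) :
    X.poly (q * (ν * q ^ (2 * k) : ℝˣ)) ≠ 0 := by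
  have hq0 : (q : ℝ) ≠ 0 := q.ne_zero
  apply poly_ne_zero_of_real hc hd
  · rintro rfl
    apply h1
    refine ⟨k + 1, ?_⟩
    simp only [mul_add, zpow_add₀ hq0, Units.val_mul, Units.val_zpow_eq_zpow_val, mul_one,
      zpow_ofNat]
    ring
  · rintro rfl
    apply h2
    refine ⟨k, ?_⟩
    simp only [Units.val_mul, Units.val_zpow_eq_zpow_val]
    field_simp

theorem mul_eq_one_of_real {c d : ℝ} (hc : X.c = c) (hd : X.d = d) : c * d = 1 := by
  have := X.mul_eq_one
  rw [hc, hd] at this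
  exact_mod_cast this

/-! ### Two-sided progressions: complementary, principal and strange series. -/

section Nontruncated

variable [Nontrivial V] {ν : ℝˣ} {v : V}

theorem isComplementarySeries_comp_J (hπ : IsStarRep π) (hq : 0 < (q : ℝ) ∧ (q : ℝ) < 1)
    (h : IsCyclicWeightVector π ν v) {c d : ℝ} (hc : X.c = c) (hd : X.d = d)
    (hc0 : 0 < c) (hcd : c < d) (h1 : (q : ℝ) * c ∉ progression q ν)
    (h2 : (q : ℝ)⁻¹ * d ∉ progression q ν)
    (h3 : ∀ t ∈ progression q ν, t ∉ Set.Ioo ((q : ℝ) * c) ((q : ℝ) * d)) (hν : 0 < (ν : ℝ)) :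
    IsComplementarySeries (π.comp (J q hq X 1)) := by
  obtain ⟨l, hl⟩ := exists_spin hq hc0
  have hdl : d = (q : ℝ) ^ (-(2 * l + 1)) := by
    rw [Real.rpow_neg hq.1.le, ← hl]
    exact eq_inv_of_mul_eq_one_right (mul_eq_one_of_real hc hd)
  obtain ⟨ε, k, hε1, hε2, hk⟩ := exists_complementary_parity hq hν hl hdl h1 h2 h3
  have hl0 : -1 / 2 < l := by
    rw [hl, hdl, rpow_lt_rpow_iff hq] at hcd
    linarith
  have hε : |ε| < -l := abs_lt.2 ⟨by linarith, hε2⟩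
  refine ⟨l, ε, hl0, by linarith, by rwa [abs_of_neg (by linarith : l < 0)],
    hasSpinParity_and_hasAllWeights hπ hq h (poly_ne_zero_of_not_mem_progression hc hd h1 h2) 1
      (m := k) (by linarith) ?_ ?_⟩
  · rw [cpow_ofReal_spin hq hl, hc]
    simp
  · rw [← hk]
    simp

theorem isPrincipalSeries_comp_J_of_eq (hπ : IsStarRep π) (hq : 0 < (q : ℝ) ∧ (q : ℝ) < 1)
    (h : IsCyclicWeightVector π ν v) {c : ℝ} (hc : X.c = c) (hd : X.d = c)
    (hc0 : 0 < c) (h1 : (q : ℝ) * c ∉ progression q ν)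
    (h2 : (q : ℝ)⁻¹ * c ∉ progression q ν) (hν : 0 < (ν : ℝ)) :
    IsPrincipalSeries (π.comp (J q hq X 1)) := by
  obtain ⟨ε, k, hε, hk⟩ := exists_parity hq hν
  have hc1 : c = 1 := by
    have := mul_eq_one_of_real hc hd
    nlinarith
  -- With `c = d = 1` the spin equation is `q^(2l+1) = 1`, solved by `l = -1/2`.
  refine ⟨0, ε, hasSpinParity_and_hasAllWeights hπ hq h
    (poly_ne_zero_of_not_mem_progression hc hd h1 h2) 1 (m := k) hε ?_ ?_⟩
  · rw [hc, hc1]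
    norm_num
  · rw [← hk]
    simp

theorem isStrangeSeries_comp_J (hπ : IsStarRep π) (hq : 0 < (q : ℝ) ∧ (q : ℝ) < 1)
    (h : IsCyclicWeightVector π ν v) {c d : ℝ} (hc : X.c = c) (hd : X.d = d)
    (hc0 : 0 < c) (h1 : (q : ℝ) * c ∉ progression q ν)
    (h2 : (q : ℝ)⁻¹ * d ∉ progression q ν) (hν : (ν : ℝ) < 0) :
    IsStrangeSeries (π.comp (J q hq X (-1))) := by
  obtain ⟨l, hl⟩ := exists_spin hq hc0
  obtain ⟨ε, k, hε, hk⟩ := exists_parity hq (neg_pos.2 hν)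
  have hlog := log_ne_zero hq
  have hlogc : (Real.log q : ℂ) ≠ 0 := by exact_mod_cast hlog
  -- The imaginary part of the spin contributes the factor `exp(iπ) = -1` to `q^(2l+1)`, which
  -- accounts for the sign `s = -1`.
  refine ⟨⟨l, Real.pi / (2 * Real.log q)⟩, ε, rfl, hasSpinParity_and_hasAllWeights hπ hq h
    (poly_ne_zero_of_not_mem_progression hc hd h1 h2) (-1) (m := k) hε ?_ ?_⟩
  · have e : (2 * (⟨l, Real.pi / (2 * Real.log q)⟩ : ℂ) + 1) =
        (2 * (l : ℂ) + 1) + Real.pi * Complex.I / Real.log q := by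
      rw [Complex.mk_eq_add_mul_I]
      push_cast
      field_simp
      ring
    rw [e, Complex.cpow_add _ _ (by simp), cpow_ofReal_spin hq hl, cpow_eq_exp hq,
      mul_div_cancel₀ _ hlogc, Complex.exp_pi_mul_I, hc]
    simp
  · rw [← hk]
    simp

theorem isPrincipalSeries_comp_J_of_conj (hπ : IsStarRep π) (hq : 0 < (q : ℝ) ∧ (q : ℝ) < 1)
    (h : IsCyclicWeightVector π ν v) (hc : X.c.im ≠ 0) (hd : X.d = conj X.c) (s : ℤˣ)
    (hν : 0 < ((s : ℤ) : ℝ) * ν) : IsPrincipalSeries (π.comp (J q hq X s)) := by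
  obtain ⟨ε, k, hε, hk⟩ := exists_parity hq hν
  have hlog := log_ne_zero hq
  have hlogc : (Real.log q : ℂ) ≠ 0 := by exact_mod_cast hlog
  -- Here `|c₀| = 1`, so `s c₀` is the exponential of `i` times its argument, while `q^(2l+1) =
  -- exp(2iτ log q)`. The roots of `X.poly` are not real, so nothing is truncated.
  refine ⟨Complex.arg (((s : ℤ) : ℂ) * X.c) / (2 * Real.log q), ε,
    hasSpinParity_and_hasAllWeights hπ hq h ?_ s (m := k) hε ?_ hk⟩
  · intro k
    generalize (q : ℝ) * (ν * q ^ (2 * k) : ℝˣ) = t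
    rw [Hyperboloid.poly, hd]
    refine mul_ne_zero (fun h0 => hc ?_) (fun h0 => hc ?_)
    · simpa using congrArg Complex.im h0
    · simpa using congrArg Complex.im h0
  · have hnorm : ‖((s : ℤ) : ℂ) * X.c‖ = 1 := by
      have h1 := X.mul_eq_one
      rw [hd, Complex.mul_conj, Complex.normSq_eq_norm_sq] at h1
      have h2 : ‖X.c‖ ^ 2 = 1 := by exact_mod_cast h1
      have h3 : ‖X.c‖ = 1 := by nlinarith [norm_nonneg X.c]
      rw [norm_mul, h3, mul_one]
      rcases Int.units_eq_one_or s with rfl | rfl <;> simp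
    rw [cpow_eq_exp hq]
    have h4 := Complex.norm_mul_exp_arg_mul_I (((s : ℤ) : ℂ) * X.c)
    rw [hnorm, Complex.ofReal_one, one_mul] at h4
    rw [← h4]
    congr 1
    rw [h4]
    push_cast
    field_simp
    ring

end Nontruncated

/-! ### One-sided progressions: the two discrete series. -/

section Truncated

variable [Nontrivial V] {ν : ℝˣ} {v : V}

/-- Moving by `y`, the progression stops at `c q`, where `X.poly` is evaluated at its root `c`.
Elsewhere it is evaluated at `c q^m` with `m ≥ 1`, which is less than `c ≤ d`, so no other step
vanishes. -/
theorem hasWeight_iff_holomorphic (hπ : IsStarRep π) (hq : 0 < (q : ℝ) ∧ (q : ℝ) < 1)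
    (h : IsCyclicWeightVector π ν v) {c : ℝˣ} {d : ℝ} (hc : X.c = (c : ℝ)) (hd : X.d = d)
    (hc0 : 0 < (c : ℝ)) (hcd : (c : ℝ) ≤ d) {k : ℕ} (hν : ν = c * q ^ (2 * k + 1)) (t : ℝˣ) :
    HasWeight π t ↔ ∃ j : ℕ, t = c * q ^ (2 * j + 1) := by
  have hpoly : ∀ m : ℕ, m ≠ 0 → X.poly ((c * q ^ m : ℝˣ) : ℝ) ≠ 0 := by
    intro m hm
    have h1 : (c : ℝ) * (q : ℝ) ^ m < c :=
      mul_lt_of_lt_one_right hc0 (pow_lt_one₀ hq.1.le hq.2 hm)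
    rw [Units.val_mul, Units.val_pow_eq_pow_val]
    exact poly_ne_zero_of_real hc hd h1.ne (h1.trans_le hcd).ne
  constructor
  · intro ht
    rcases h.weight_cases ht with ⟨n, rfl, hn⟩ | ⟨n, rfl, -⟩
    · have hnk : n ≤ k := by
        by_contra! hkn
        apply hn
        obtain ⟨i, rfl⟩ := Nat.exists_eq_add_of_le hkn
        -- The vector `y^k v` has weight `c q`, so `y^(k+1) v = 0`.
        have h1 := (h.weight.y_pow k).y_eq_zero hπ (by
          have e : (q⁻¹ * ((q⁻¹ ^ 2) ^ k * ν) : ℝˣ) = c := by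
            rw [hν, ← pow_mul, mul_left_comm, ← mul_assoc, ← mul_assoc, mul_assoc, ← pow_succ,
              inv_pow, mul_comm c]
            simp
          rw [e, Hyperboloid.poly, hc, sub_self, zero_mul])
        rw [Nat.succ_eq_add_one, add_comm, pow_add, pow_succ', Module.End.mul_apply,
          Module.End.mul_apply, h1, map_zero]
      obtain ⟨j, rfl⟩ := Nat.exists_eq_add_of_le hnk
      refine ⟨j, ?_⟩
      rw [hν, ← pow_mul, mul_left_comm, show 2 * (n + j) + 1 = 2 * n + (2 * j + 1) by ring,
        pow_add, inv_pow, inv_mul_cancel_left]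
    · refine ⟨n + k, ?_⟩
      rw [hν, ← pow_mul, mul_left_comm, ← pow_add]
      ring_nf
  · have down : ∀ i j : ℕ, HasWeight π (c * q ^ (2 * (i + j) + 1)) →
        HasWeight π (c * q ^ (2 * i + 1)) := by
      intro i j
      induction j with
      | zero => exact id
      | succ j ih =>
        intro hw
        apply ih
        have e : (q⁻¹ * (c * q ^ (2 * (i + (j + 1)) + 1)) : ℝˣ) = c * q ^ (2 * (i + j) + 2) := by
          rw [mul_left_comm, show 2 * (i + (j + 1)) + 1 = 2 * (i + j) + 2 + 1 by ring,
            pow_succ' q (_ + 2), inv_mul_cancel_left]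
        have h1 := hw.y (by rw [e]; exact hpoly _ (by omega))
        rwa [mul_left_comm, show 2 * (i + (j + 1)) + 1 = 2 + (2 * (i + j) + 1) by ring,
            pow_add q 2, inv_pow, inv_mul_cancel_left] at h1
    have up : ∀ j : ℕ, HasWeight π (c * q ^ (2 * (k + j) + 1)) := by
      intro j
      induction j with
      | zero =>
        rw [add_zero, ← hν]
        exact h.hasWeight
      | succ j ih =>
        have h1 := ih.yh (by
          rw [mul_left_comm, ← pow_succ']
          exact hpoly _ (by omega))
        rw [mul_left_comm, ← pow_add] at h1
        convert h1 using 3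
        ring
    -- Whichever of `j`, `k` is larger, index `j` is reached from `k` by going out to `k + j` with
    -- `ŷ` and back with `y`.
    rintro ⟨j, rfl⟩
    apply down j k
    rw [add_comm j k]
    exact up j

/-- The mirror image of the holomorphic case: `y` and `ŷ`, `q` and `q⁻¹`, `c` and `d` exchange
roles, and `ŷ` stops at `d q⁻¹`. -/
theorem hasWeight_iff_antiholomorphic (hπ : IsStarRep π) (hq : 0 < (q : ℝ) ∧ (q : ℝ) < 1)
    (h : IsCyclicWeightVector π ν v) {c : ℝ} {d : ℝˣ} (hc : X.c = c) (hd : X.d = (d : ℝ))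
    (hd0 : 0 < (d : ℝ)) (hcd : c ≤ (d : ℝ)) {k : ℕ} (hν : ν = d * q⁻¹ ^ (2 * k + 1)) (t : ℝˣ) :
    HasWeight π t ↔ ∃ j : ℕ, t = d * q⁻¹ ^ (2 * j + 1) := by
  have hpoly : ∀ m : ℕ, m ≠ 0 → X.poly ((d * q⁻¹ ^ m : ℝˣ) : ℝ) ≠ 0 := by
    intro m hm
    have h1 : (d : ℝ) < (d : ℝ) * (q : ℝ)⁻¹ ^ m :=
      lt_mul_of_one_lt_right hd0 (one_lt_pow₀ ((one_lt_inv₀ hq.1).2 hq.2) hm)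
    rw [Units.val_mul, Units.val_pow_eq_pow_val, Units.val_inv_eq_inv_val]
    exact poly_ne_zero_of_real hc hd (hcd.trans_lt h1).ne' h1.ne'
  constructor
  · intro ht
    rcases h.weight_cases ht with ⟨n, rfl, -⟩ | ⟨n, rfl, hn⟩
    · refine ⟨n + k, ?_⟩
      rw [hν, ← pow_mul, mul_left_comm, ← pow_add]
      ring_nf
    · have hnk : n ≤ k := by
        by_contra! hkn
        apply hn
        obtain ⟨i, rfl⟩ := Nat.exists_eq_add_of_le hkn
        have h1 := (h.weight.yh_pow k).yh_eq_zero hπ (by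
          have e : (q * ((q ^ 2) ^ k * ν) : ℝˣ) = d := by
            rw [hν, ← pow_mul, ← mul_assoc, ← pow_succ', inv_pow, mul_comm d,
              mul_inv_cancel_left]
          rw [e, Hyperboloid.poly, hd, sub_self, mul_zero])
        rw [Nat.succ_eq_add_one, add_comm, pow_add, pow_succ', Module.End.mul_apply,
          Module.End.mul_apply, h1, map_zero]
      obtain ⟨j, rfl⟩ := Nat.exists_eq_add_of_le hnk
      refine ⟨j, ?_⟩
      rw [hν, ← pow_mul, mul_left_comm, show 2 * (n + j) + 1 = 2 * n + (2 * j + 1) by ring,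
        pow_add, inv_pow, mul_inv_cancel_left]
  · have down : ∀ i j : ℕ, HasWeight π (d * q⁻¹ ^ (2 * (i + j) + 1)) →
        HasWeight π (d * q⁻¹ ^ (2 * i + 1)) := by
      intro i j
      induction j with
      | zero => exact id
      | succ j ih =>
        intro hw
        apply ih
        have e : (q * (d * q⁻¹ ^ (2 * (i + (j + 1)) + 1)) : ℝˣ) =
            d * q⁻¹ ^ (2 * (i + j) + 2) := by
          rw [mul_left_comm, show 2 * (i + (j + 1)) + 1 = 2 * (i + j) + 2 + 1 by ring,
            pow_succ' q⁻¹ (_ + 2), mul_inv_cancel_left]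
        have h1 := hw.yh (by rw [e]; exact hpoly _ (by omega))
        rwa [mul_left_comm, show 2 * (i + (j + 1)) + 1 = 2 + (2 * (i + j) + 1) by ring,
            pow_add q⁻¹ 2, inv_pow q 2, mul_inv_cancel_left] at h1
    have up : ∀ j : ℕ, HasWeight π (d * q⁻¹ ^ (2 * (k + j) + 1)) := by
      intro j
      induction j with
      | zero =>
        rw [add_zero, ← hν]
        exact h.hasWeight
      | succ j ih =>
        have h1 := ih.y (by
          rw [mul_left_comm, ← pow_succ']
          exact hpoly _ (by omega))
        rw [mul_left_comm, ← pow_add] at h1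
        convert h1 using 3
        ring
    rintro ⟨j, rfl⟩
    apply down j k
    rw [add_comm j k]
    exact up j

theorem isHolomorphicSeries_comp_J (hπ : IsStarRep π) (hq : 0 < (q : ℝ) ∧ (q : ℝ) < 1)
    (h : IsCyclicWeightVector π ν v) {c d : ℝ} (hc : X.c = c) (hd : X.d = d)
    (hc0 : 0 < c) (hcd : c ≤ d) {k : ℕ} (hν : (ν : ℝ) = c * (q : ℝ) ^ (2 * k + 1)) :
    IsHolomorphicSeries (π.comp (J q hq X 1)) := by
  obtain ⟨l, hl⟩ := exists_spin hq hc0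
  have hw := hasWeight_iff_holomorphic hπ hq h (c := Units.mk0 c hc0.ne') hc hd hc0 hcd
    (k := k) (Units.ext hν)
  have hval : ∀ j : ℕ, c * (q : ℝ) ^ (2 * j + 1) = (q : ℝ) ^ (2 * (l + 1 + (j : ℝ))) := by
    intro j
    rw [hl, ← Real.rpow_natCast, ← Real.rpow_add hq.1]
    push_cast
    ring_nf
  -- Rounding `l` gives a parity congruent to `l` modulo `ℤ` with absolute value at most `1/2`.
  refine ⟨l, l - round l, ⟨round l, by ring⟩, ?_, ?_⟩
  · apply hasSpinParity_of_cyclic hπ hq h 1 (abs_sub_round l)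
    · rw [cpow_ofReal_spin hq hl, hc]
      simp
    · intro t ht
      obtain ⟨j, rfl⟩ := (hw t).1 ht
      refine ⟨round l + 1 + j, ?_⟩
      rw [Units.val_mul, Units.val_mk0, Units.val_pow_eq_pow_val, hval]
      push_cast
      ring_nf
  · intro μ
    rw [hasEigenvalue_K_iff hπ]
    constructor
    · rintro ⟨t, ht, rfl⟩
      obtain ⟨j, rfl⟩ := (hw t).1 ht
      refine ⟨j, ?_⟩
      rw [Units.val_mul, Units.val_mk0, Units.val_pow_eq_pow_val, hval]
      simp
    · rintro ⟨j, rfl⟩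
      refine ⟨_, (hw _).2 ⟨j, rfl⟩, ?_⟩
      rw [Units.val_mul, Units.val_mk0, Units.val_pow_eq_pow_val, hval]
      simp

theorem isAntiholomorphicSeries_comp_J (hπ : IsStarRep π) (hq : 0 < (q : ℝ) ∧ (q : ℝ) < 1)
    (h : IsCyclicWeightVector π ν v) {c d : ℝ} (hc : X.c = c) (hd : X.d = d)
    (hc0 : 0 < c) (hcd : c ≤ d) {k : ℕ} (hν : (ν : ℝ) = d * (q : ℝ)⁻¹ ^ (2 * k + 1)) :
    IsAntiholomorphicSeries (π.comp (J q hq X 1)) := by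
  have hd0 := hc0.trans_le hcd
  obtain ⟨l, hl⟩ := exists_spin hq hc0
  have hdl : d = (q : ℝ) ^ (-(2 * l + 1)) := by
    rw [Real.rpow_neg hq.1.le, ← hl]
    exact eq_inv_of_mul_eq_one_right (mul_eq_one_of_real hc hd)
  have hw := hasWeight_iff_antiholomorphic hπ hq h (d := Units.mk0 d hd0.ne') hc hd hd0 hcd
    (k := k) (Units.ext (by simpa using hν))
  have hval : ∀ j : ℕ, d * (q : ℝ)⁻¹ ^ (2 * j + 1) = (q : ℝ) ^ (-2 * (l + 1 + (j : ℝ))) := by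
    intro j
    rw [hdl, inv_pow, ← Real.rpow_natCast, ← Real.rpow_neg hq.1.le, ← Real.rpow_add hq.1]
    push_cast
    ring_nf
  -- The weights now have exponents `-2(l + 1 + j)`, so the parity must be congruent to `-l`.
  refine ⟨l, round l - l, ⟨round l, by ring⟩, ?_, ?_⟩
  · apply hasSpinParity_of_cyclic hπ hq h 1
    · rw [abs_sub_comm]
      exact abs_sub_round l
    · rw [cpow_ofReal_spin hq hl, hc]
      simp
    · intro t ht
      obtain ⟨j, rfl⟩ := (hw t).1 ht
      refine ⟨-(round l + 1 + j), ?_⟩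
      rw [Units.val_mul, Units.val_mk0, Units.val_pow_eq_pow_val, Units.val_inv_eq_inv_val, hval]
      push_cast
      ring_nf
  · intro μ
    rw [hasEigenvalue_K_iff hπ]
    constructor
    · rintro ⟨t, ht, rfl⟩
      obtain ⟨j, rfl⟩ := (hw t).1 ht
      refine ⟨j, ?_⟩
      rw [Units.val_mul, Units.val_mk0, Units.val_pow_eq_pow_val, Units.val_inv_eq_inv_val, hval]
      simp
    · rintro ⟨j, rfl⟩
      refine ⟨_, (hw _).2 ⟨j, rfl⟩, ?_⟩
      rw [Units.val_mul, Units.val_mk0, Units.val_pow_eq_pow_val, Units.val_inv_eq_inv_val, hval]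
      simp

end Truncated

end Series

end QuantumOrbit

theorem mainTheorem3 (q : ℝˣ) (hq : 0 < (q : ℝ) ∧ (q : ℝ) < 1) (X : Hyperboloid)
    {V : Type*} [NormedAddCommGroup V] [InnerProductSpace ℂ V]
    (π : Func q X →ₐ[ℂ] Module.End ℂ V) (hπ : IsStarRep π) :
    -- the composite with the moment map, for either choice of the square root of `c₀ d₀ = 1`
    (∀ s : ℤˣ,
      IsStarRep (π.comp (J q hq X s)) ∧
      (IsIrreducibleRep π → IsIrreducibleRep (π.comp (J q hq X s))) ∧
      (IsSimpleRep π → IsSimpleRep (π.comp (J q hq X s)))) ∧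
    -- the representations in (quotients of) the induced modules
    (Nontrivial V → ∀ ν : ℝˣ, IsQuotientOfInduced ν π →
      -- two-sheet hyperboloids and the cone, no truncation
      (∀ c d : ℝ, X.c = c → X.d = d → 0 < c → c ≤ d →
        (q : ℝ) * c ∉ progression q ν → (q : ℝ)⁻¹ * d ∉ progression q ν →
        (∀ t ∈ progression q ν, t ∉ Set.Ioo ((q : ℝ) * c) ((q : ℝ) * d)) →
        (0 < (ν : ℝ) → c < d → IsComplementarySeries (π.comp (J q hq X 1))) ∧
        (0 < (ν : ℝ) → c = d → IsPrincipalSeries (π.comp (J q hq X 1))) ∧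
        ((ν : ℝ) < 0 → IsStrangeSeries (π.comp (J q hq X (-1))))) ∧
      -- one-sheet hyperboloids
      (X.c.im ≠ 0 → X.d = (starRingEnd ℂ) X.c →
        (0 < (ν : ℝ) → IsPrincipalSeries (π.comp (J q hq X 1))) ∧
        ((ν : ℝ) < 0 → IsPrincipalSeries (π.comp (J q hq X (-1))))) ∧
      -- two-sheet hyperboloids and the cone, truncated progressions
      (∀ c d : ℝ, X.c = c → X.d = d → 0 < c → c ≤ d →
        ((∃ k : ℕ, (ν : ℝ) = c * (q : ℝ) ^ (2 * k + 1)) →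
          IsHolomorphicSeries (π.comp (J q hq X 1))) ∧
        ((∃ k : ℕ, (ν : ℝ) = d * (q : ℝ)⁻¹ ^ (2 * k + 1)) →
          IsAntiholomorphicSeries (π.comp (J q hq X 1))))) := by
  refine ⟨fun s => ⟨hπ.comp_J hq s, .comp_J hq hπ s, .comp_J hq hπ s⟩, ?_⟩
  intro _ ν hquot
  obtain ⟨v, h⟩ := hquot.exists_cyclic
  refine ⟨?_, ?_, ?_⟩
  · intro c d hc hd hc0 hcd h1 h2 h3
    refine ⟨fun hν hlt => isComplementarySeries_comp_J hπ hq h hc hd hc0 hlt h1 h2 h3 hν, ?_,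
      isStrangeSeries_comp_J hπ hq h hc hd hc0 h1 h2⟩
    rintro hν rfl
    exact isPrincipalSeries_comp_J_of_eq hπ hq h hc hd hc0 h1 h2 hν
  · intro hc hd
    exact ⟨fun hν => isPrincipalSeries_comp_J_of_conj hπ hq h hc hd 1 (by simpa using hν),
      fun hν => isPrincipalSeries_comp_J_of_conj hπ hq h hc hd (-1) (by simpa using hν)⟩
  · intro c d hc hd hc0 hcd
    exact ⟨fun ⟨k, hν⟩ => isHolomorphicSeries_comp_J hπ hq h hc hd hc0 hcd hν,
      fun ⟨k, hν⟩ => isAntiholomorphicSeries_comp_J hπ hq h hc hd hc0 hcd hν⟩
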